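/- For $p\in\mathbb{R}^3$ write $\widehat p = p/\sqrt{1+|p|^2}$, and for $R>0$ let $B_R\subset\mathbb{R}^3$ be the open ball of radius $R$ about the origin. Let $R>0$ and $\psi\in C_c^\infty(B_R)$. Then there exists a constant $C>0$ (depending only on $R$ and $\psi$) such that the following holds. Let $h,g_0\in L^2(\mathbb{R}\times\mathbb{R}^3\times B_R)$ be scalar-valued and $g_1\in L^2(\mathbb{R}\times\mathbb{R}^3\times B_R)$ be vector-valued with three components (real or complex), and suppose that $$\partial_t h+\widehat p\cdot\partial_x h = g_0+\operatorname{div}_p g_1$$ in the sense of distributions on $\mathbb{R}\times\mathbb{R}^3\times B_R$, i.e. for every $\phi\in C_c^\infty(\mathbb{R}\times\mathbb{R}^3\times B_R)$, $$-\iiint h\,(\partial_t\phi+\widehat p\cdot\partial_x\phi)\,dp\,dx\,dt=\iiint g_0\,\phi\,dp\,dx\,dt-\iiint g_1\cdot\partial_p\phi\,dp\,dx\,dt .$$ Then the momentum average $u(t,x)=\int_{B_R}\psi(p)\,h(t,x,p)\,dp$, which is defined for almost every $(t,x)$, belongs to $H^{1/4}(\mathbb{R}\times\mathbb{R}^3)$,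 and $$\|u\|_{H^{1/4}}\le C\left(\|h\|_{L^2(\mathbb{R}\times\mathbb{R}^3\times B_R)}+\|g_0\|_{L^2(\mathbb{R}\times\mathbb{R}^3\times B_R)}+\|g_1\|_{L^2(\mathbb{R}\times\mathbb{R}^3\times B_R)}\right).$$ Here $H^{s}(\mathbb{R}\times\mathbb{R}^3)$ is the Sobolev space defined by the Fourier transform, with norm $\|u\|_{H^{s}}=\|(1+|\zeta|^2)^{s/2}\,\hat u\|_{L^2(\mathbb{R}^4)}$. -/

import Mathlib

open MeasureTheory TopologicalSpace
open scoped FourierTransform SchwartzMap Distributions ENNReal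

namespace MomentumAveraging

/-- Position or momentum space `ℝ³` with its Euclidean norm. -/
abbrev E3 : Type := EuclideanSpace ℝ (Fin 3)

/-- Space-time `ℝ × ℝ³`, with points `(t, x)` and the Euclidean norm `√(t² + |x|²)`;
its `volume` is Lebesgue measure. -/
abbrev SpaceTime : Type := WithLp 2 (ℝ × E3)

/-- The relativistic velocity `p̂ = p / √(1 + |p|²)` of a particle with momentum `p`. -/
noncomputable def velocity (p : E3) : E3 := (√(1 + ‖p‖ ^ 2))⁻¹ • p

/-- The open ball `B_R ⊆ ℝ³` about the origin. -/
def momentumBall (R : ℝ) : Opens E3 := ⟨Metric.ball 0 R, Metric.isOpen_ball⟩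

/-- The open set `ℝ × ℝ³ × B_R` of all `((t, x), p)` with `|p| < R`. -/
def phaseDomain (R : ℝ) : Opens (SpaceTime × E3) :=
  ⟨Set.univ ×ˢ Metric.ball 0 R, isOpen_univ.prod Metric.isOpen_ball⟩

/-- Lebesgue measure on `ℝ × ℝ³ × B_R`. -/
noncomputable def phaseMeasure (R : ℝ) : Measure (SpaceTime × E3) :=
  volume.restrict (phaseDomain R : Set (SpaceTime × E3))

/-- The partial derivative `∂_t φ`. -/
noncomputable def partialT (φ : SpaceTime × E3 → ℂ) (y : SpaceTime × E3) : ℂ :=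
  fderiv ℝ φ y (WithLp.toLp 2 (1, 0), 0)

/-- The partial derivative `∂_{x_i} φ`. -/
noncomputable def partialX (i : Fin 3) (φ : SpaceTime × E3 → ℂ) (y : SpaceTime × E3) : ℂ :=
  fderiv ℝ φ y (WithLp.toLp 2 (0, EuclideanSpace.single i 1), 0)

/-- The partial derivative `∂_{p_i} φ`. -/
noncomputable def partialP (i : Fin 3) (φ : SpaceTime × E3 → ℂ) (y : SpaceTime × E3) : ℂ :=
  fderiv ℝ φ y (0, EuclideanSpace.single i 1)

/-- The equation `∂_t h + p̂ · ∂_x h = g₀ + div_p g₁` on `ℝ × ℝ³ × B_R` in the sense of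
distributions: all derivatives are moved onto a test function `φ ∈ C_c^∞(ℝ × ℝ³ × B_R)`. -/
def IsDistribSolution (R : ℝ) (h g₀ : SpaceTime × E3 → ℂ)
    (g₁ : SpaceTime × E3 → EuclideanSpace ℂ (Fin 3)) : Prop :=
  ∀ φ : 𝓓(phaseDomain R, ℂ),
    -∫ y, h y * (partialT φ y + ∑ i, (velocity y.2 i : ℂ) * partialX i φ y) ∂(phaseMeasure R) =
      ∫ y, g₀ y * φ y ∂(phaseMeasure R) -
        ∫ y, ∑ i, g₁ y i * partialP i φ y ∂(phaseMeasure R)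

/-- The momentum average `∫ ψ(p) h(t, x, p) dp` over `B_R`. -/
noncomputable def average (R : ℝ) (ψ : E3 → ℂ) (h : SpaceTime × E3 → ℂ) (z : SpaceTime) : ℂ :=
  ∫ p in Metric.ball 0 R, ψ p * h (z, p)

/-- The norm `‖(1 + |ζ|²)^{s/2} û‖_{L²}` of the Sobolev space `H^s(ℝ × ℝ³)`, for `u ∈ L²`;
it is `∞` if `u` is not in `H^s`. -/
noncomputable def sobolevNorm (s : ℝ) (u : Lp ℂ 2 (volume : Measure SpaceTime)) : ℝ≥0∞ :=
  eLpNorm (fun ζ : SpaceTime => (((1 + ‖ζ‖ ^ 2) ^ (s / 2) : ℝ) : ℂ) *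
    (𝓕 u : Lp ℂ 2 (volume : Measure SpaceTime)) ζ) 2 volume

end MomentumAveraging

namespace MomentumAveraging

open Set Filter Topology

/-! The proof is by duality on the Fourier side. Write `ζ = (τ, ξ)`, `⟨ζ⟩ = √(1 + |ζ|²)`, `b = τ +
p̂ · ξ` and `D = √⟨ζ⟩ + i b`. For a smooth compactly supported `θ`, the pairing of `û` with `θ` is
the integral of `h` against `ψ(p) 𝓕θ(z)`. Let `T` be the transport operator and `F` the Fourier
transform in space-time with `p` as a parameter. Splitting `ψ = √⟨ζ⟩ ψ/D + i b ψ/D` gives `ψ 𝓕θ =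
F(θ √⟨ζ⟩ ψ/D) - (2π)⁻¹ T F(θ ψ/D)` (`transport_partialFourier`). The equation turns the last term
into pairings of `g₀` with `F(θ ψ/D)` and of `g₁` with its momentum derivatives.

All the symbols that occur, namely `√⟨ζ⟩ ψ/D`, `ψ/D` and `∂_p (ψ/D)`, have squared modulus at most a
constant times `⟨ζ⟩ / (⟨ζ⟩ + b²)` (`exists_symbol_bounds`). The regularization `√⟨ζ⟩` balances the
loss in the first symbol against the factor `|ζ|` produced by `∂_p D⁻¹` in the third.

The gain is that this kernel integrates over `p ∈ B_R` to `O(⟨ζ⟩^{-1/2})`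
(`exists_setLIntegral_kernel_le`): when `|ξ|` dominates, `b` is strictly monotone along `ξ` with
slope comparable to `|ξ|`, so it is small only on a thin set; when `|τ|` dominates, `|p̂|` bounded
away from `1` prevents `b` from being small. Plancherel and Cauchy–Schwarz then bound the pairing by
the data norms times `‖⟨ζ⟩^{-1/4} θ‖`, which is dual to the `H^{1/4}` norm
(`eLpNorm_weight_mul_le_of_forall_contDiff`). -/

/-! ### Momentum integrals of the resolvent kernel -/

/-- If `f' ≥ m > 0` on `[0, L]` then `∫ ds / (ε² + f²) ≤ π / (m ε)`. -/
lemma intervalIntegral_inv_sq_add_sq_le {f f' : ℝ → ℝ} {L m ε : ℝ} (hL : 0 ≤ L) (hm : 0 < m)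
    (hε : 0 < ε) (hf : ∀ s, HasDerivAt f (f' s) s) (hc : Continuous f')
    (hf' : ∀ s ∈ Icc 0 L, m ≤ f' s) :
    ∫ s in (0 : ℝ)..L, (ε ^ 2 + f s ^ 2)⁻¹ ≤ Real.pi / (m * ε) := by
  have hfc : Continuous f := continuous_iff_continuousAt.2 fun s => (hf s).continuousAt
  have hpos : ∀ s, 0 < ε ^ 2 + f s ^ 2 := fun s => by positivity
  have hd : ∀ s, HasDerivAt (fun s => Real.arctan (f s / ε) / (m * ε))
      (f' s / m * (ε ^ 2 + f s ^ 2)⁻¹) s := fun s => by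
    have h1 := (((hf s).div_const ε).arctan).div_const (m * ε)
    refine h1.congr_deriv ?_
    have := hpos s
    have h2 : 1 + (f s / ε) ^ 2 = (ε ^ 2 + f s ^ 2) / ε ^ 2 := by field_simp
    rw [h2]
    field_simp
  have hc1 : Continuous fun s => (ε ^ 2 + f s ^ 2)⁻¹ :=
    (continuous_const.add (hfc.pow 2)).inv₀ fun s => (hpos s).ne'
  have hc2 : Continuous fun s => f' s / m * (ε ^ 2 + f s ^ 2)⁻¹ := (hc.div_const m).mul hc1
  calc ∫ s in (0 : ℝ)..L, (ε ^ 2 + f s ^ 2)⁻¹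
      ≤ ∫ s in (0 : ℝ)..L, f' s / m * (ε ^ 2 + f s ^ 2)⁻¹ := by
        refine intervalIntegral.integral_mono_on hL (hc1.intervalIntegrable _ _)
          (hc2.intervalIntegrable _ _) fun s hs => ?_
        refine le_mul_of_one_le_left (inv_nonneg.2 (hpos s).le) ?_
        rw [le_div_iff₀ hm, one_mul]
        exact hf' s hs
    _ = Real.arctan (f L / ε) / (m * ε) - Real.arctan (f 0 / ε) / (m * ε) :=
        intervalIntegral.integral_eq_sub_of_hasDerivAt (fun s _ => hd s)
          (hc2.intervalIntegrable _ _)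
    _ ≤ Real.pi / (m * ε) := by
        rw [← sub_div]
        have h1 := Real.arctan_lt_pi_div_two (f L / ε)
        have h2 := Real.neg_pi_div_two_lt_arctan (f 0 / ε)
        gcongr
        linarith

/-- The derivative of the velocity component `e · p̂` along a line with unit direction `e`. -/
lemma hasDerivAt_inner_velocity_line {p e : E3} (he : ‖e‖ = 1) (s : ℝ) :
    HasDerivAt (fun s : ℝ => inner ℝ e (velocity (p + s • e)))
      ((1 + ‖p‖ ^ 2 - inner ℝ e p ^ 2) * (√(1 + ‖p + s • e‖ ^ 2) ^ 3)⁻¹) s := by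
  have hn : ∀ s : ℝ, ‖p + s • e‖ ^ 2 = ‖p‖ ^ 2 + 2 * s * inner ℝ e p + s ^ 2 := fun s => by
    rw [norm_add_sq_real, inner_smul_right, norm_smul, he, real_inner_comm]
    simp; ring
  have hi : ∀ s : ℝ, inner ℝ e (velocity (p + s • e))
      = (√(1 + (‖p‖ ^ 2 + 2 * s * inner ℝ e p + s ^ 2)))⁻¹ * (inner ℝ e p + s) := fun s => by
    rw [velocity, inner_smul_right, inner_add_right, inner_smul_right,
      real_inner_self_eq_norm_sq, he, hn]
    ring
  rw [funext hi, hn]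
  set c := inner ℝ e p
  have hP : 0 < 1 + (‖p‖ ^ 2 + 2 * s * c + s ^ 2) := by rw [← hn]; positivity
  have h1 : HasDerivAt (fun s : ℝ => 1 + (‖p‖ ^ 2 + 2 * s * c + s ^ 2)) (2 * (c + s)) s := by
    have h := ((((hasDerivAt_id s).const_mul 2).mul_const c).const_add (‖p‖ ^ 2)).add
      ((hasDerivAt_id s).pow 2) |>.const_add 1
    refine h.congr_deriv ?_
    simp; ring
  have h2 := ((h1.sqrt hP.ne').inv (Real.sqrt_pos.2 hP).ne').mul ((hasDerivAt_id s).const_add c)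
  refine h2.congr_deriv ?_
  have hs : 0 < √(1 + (‖p‖ ^ 2 + 2 * s * c + s ^ 2)) := Real.sqrt_pos.2 hP
  have hsq := Real.sq_sqrt hP.le
  simp only [id, Pi.inv_apply]
  set r := √(1 + (‖p‖ ^ 2 + 2 * s * c + s ^ 2))
  field_simp
  linear_combination hsq

/-- Averaging the translation-invariant integral of `1_{B_R} F` over shifts `s • e` with `0 ≤ s ≤ R`
and applying Fubini leaves line integrals, which vanish unless the base point lies in `B_{2R}`. A
one-dimensional estimate along `e` thus suffices, with no rotation of coordinates. -/
lemma lintegral_ball_le_translate {F : E3 → ℝ≥0∞} (hF : Measurable F) {R : ℝ} (hR : 0 < R)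
    {e : E3} (he : ‖e‖ = 1) {A : ℝ≥0∞}
    (hA : ∀ p ∈ Metric.ball (0 : E3) (2 * R), ∫⁻ s in Icc (0 : ℝ) R, F (p + s • e) ≤ A) :
    ∫⁻ p in Metric.ball 0 R, F p ≤
      (ENNReal.ofReal R)⁻¹ * (volume (Metric.ball (0 : E3) (2 * R)) * A) := by
  set G : E3 → ℝ≥0∞ := (Metric.ball 0 R).indicator F with hG
  have hGm : Measurable G := hF.indicator measurableSet_ball
  have h1 : ENNReal.ofReal R * ∫⁻ p in Metric.ball 0 R, F p
      = ∫⁻ p, ∫⁻ s in Icc (0 : ℝ) R, G (p + s • e) := by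
    rw [lintegral_lintegral_swap (by fun_prop)]
    simp_rw [lintegral_add_right_eq_self (μ := (volume : Measure E3)) G]
    rw [lintegral_const, hG, lintegral_indicator measurableSet_ball]
    simp [mul_comm]
  have h2 : ∫⁻ p, ∫⁻ s in Icc (0 : ℝ) R, G (p + s • e)
      ≤ ∫⁻ p, (Metric.ball (0 : E3) (2 * R)).indicator (fun _ => A) p := by
    refine lintegral_mono fun p => ?_
    by_cases hp : p ∈ Metric.ball (0 : E3) (2 * R)
    · rw [indicator_of_mem hp]
      refine le_trans (lintegral_mono fun s => ?_) (hA p hp)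
      exact indicator_le_self _ _ _
    · rw [indicator_of_notMem hp, nonpos_iff_eq_zero]
      refine setLIntegral_eq_zero measurableSet_Icc fun s hs => ?_
      refine indicator_of_notMem (fun hm => hp ?_) _
      rw [mem_ball_zero_iff] at hm ⊢
      calc ‖p‖ = ‖(p + s • e) - s • e‖ := by simp
        _ ≤ ‖p + s • e‖ + ‖s • e‖ := norm_sub_le _ _
        _ < 2 * R := by
          rw [norm_smul, he, mul_one, Real.norm_of_nonneg hs.1]; linarith [hs.2]
  rw [lintegral_indicator measurableSet_ball, setLIntegral_const] at h2
  rw [← h1, mul_comm A] at h2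
  have hR0 : ENNReal.ofReal R ≠ 0 := by simpa using hR
  calc _ = (ENNReal.ofReal R)⁻¹ * (ENNReal.ofReal R * ∫⁻ p in Metric.ball 0 R, F p) := by
        rw [← mul_assoc, ENNReal.inv_mul_cancel hR0 ENNReal.ofReal_ne_top, one_mul]
    _ ≤ _ := by gcongr

lemma continuous_velocity : Continuous velocity := by
  unfold velocity
  have h : Continuous fun p : E3 => √(1 + ‖p‖ ^ 2) := by fun_prop
  exact (h.inv₀ fun p => by positivity).smul continuous_id

/-- The space-time velocity `(1, p̂)`. -/
noncomputable def worldVelocity (p : E3) : SpaceTime := WithLp.toLp 2 (1, velocity p)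

lemma inner_worldVelocity (ζ : SpaceTime) (p : E3) :
    inner ℝ ζ (worldVelocity p) = ζ.fst + inner ℝ ζ.snd (velocity p) := by
  simp [worldVelocity, WithLp.prod_inner_apply]

lemma contDiff_velocity : ContDiff ℝ (⊤ : ℕ∞) velocity := by
  unfold velocity
  have h1 : ∀ p : E3, (1 + ‖p‖ ^ 2) ≠ 0 := fun p => by positivity
  have h2 : ContDiff ℝ (⊤ : ℕ∞) fun p : E3 => √(1 + ‖p‖ ^ 2) :=
    (contDiff_const.add (contDiff_norm_sq ℝ)).sqrt h1
  exact (h2.inv fun p => by positivity).smul contDiff_id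

lemma contDiff_worldVelocity : ContDiff ℝ (⊤ : ℕ∞) worldVelocity := by
  unfold worldVelocity
  exact (WithLp.prodContinuousLinearEquiv 2 ℝ ℝ E3).symm.contDiff.comp
    (contDiff_const.prodMk contDiff_velocity)

/-- Speeds on a bounded momentum ball stay uniformly below `1`, which rules out resonance at
frequencies with `|τ| ≥ |ξ|`. -/
lemma norm_velocity_le_of_mem_ball {R : ℝ} {p : E3} (hp : p ∈ Metric.ball 0 R) :
    ‖velocity p‖ ≤ R / √(1 + R ^ 2) := by
  rw [mem_ball_zero_iff] at hp
  have hR : 0 < R := (norm_nonneg p).trans_lt hp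
  rw [velocity, norm_smul, norm_inv, Real.norm_of_nonneg (Real.sqrt_nonneg _), inv_mul_eq_div,
    div_le_div_iff₀ (by positivity) (by positivity)]
  refine le_of_sq_le_sq ?_ (by positivity)
  rw [mul_pow, mul_pow, Real.sq_sqrt (by positivity), Real.sq_sqrt (by positivity)]
  nlinarith [norm_nonneg p]

/-- The Japanese bracket `√(1 + |ζ|²)`. -/
noncomputable def bracket (ζ : SpaceTime) : ℝ := √(1 + ‖ζ‖ ^ 2)

lemma one_le_bracket (ζ : SpaceTime) : 1 ≤ bracket ζ :=
  Real.one_le_sqrt.2 (by nlinarith [norm_nonneg ζ])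

lemma bracket_sq (ζ : SpaceTime) : bracket ζ ^ 2 = 1 + ‖ζ‖ ^ 2 := Real.sq_sqrt (by positivity)

/-- In the direction `e = ξ / |ξ|` the phase `τ + ξ · p̂` has derivative at least `|ξ| (1 +
9R²)^{-3/2}`, so the arctangent bound applies on each segment. -/
lemma setLIntegral_resolvent_le {R : ℝ} (hR : 0 < R) {ε τ : ℝ} (hε : 0 < ε) {ξ : E3}
    (hξ : ξ ≠ 0) :
    ∫⁻ p in Metric.ball 0 R, ENNReal.ofReal ((ε ^ 2 + (τ + inner ℝ ξ (velocity p)) ^ 2)⁻¹) ≤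
      (ENNReal.ofReal R)⁻¹ * (volume (Metric.ball (0 : E3) (2 * R)) *
        ENNReal.ofReal (Real.pi / (‖ξ‖ * (√(1 + (3 * R) ^ 2) ^ 3)⁻¹ * ε))) := by
  have hξ' : 0 < ‖ξ‖ := norm_pos_iff.2 hξ
  set e : E3 := ‖ξ‖⁻¹ • ξ with he
  have he1 : ‖e‖ = 1 := by rw [he, norm_smul]; simp [hξ'.ne']
  have hξe : ξ = ‖ξ‖ • e := by rw [he, smul_smul, mul_inv_cancel₀ hξ'.ne', one_smul]
  have hcont : Continuous fun p : E3 => (ε ^ 2 + (τ + inner ℝ ξ (velocity p)) ^ 2)⁻¹ := by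
    have := continuous_velocity
    exact Continuous.inv₀ (by fun_prop) fun p => by positivity
  refine lintegral_ball_le_translate hcont.measurable.ennreal_ofReal hR he1 fun p hp => ?_
  have hline : Continuous fun s : ℝ => p + s • e := by fun_prop
  have hd : ∀ s, HasDerivAt (fun s : ℝ => τ + inner ℝ ξ (velocity (p + s • e)))
      (‖ξ‖ * ((1 + ‖p‖ ^ 2 - inner ℝ e p ^ 2) * (√(1 + ‖p + s • e‖ ^ 2) ^ 3)⁻¹)) s := fun s => by
    have h := ((hasDerivAt_inner_velocity_line (p := p) he1 s).const_mul ‖ξ‖).const_add τ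
    refine h.congr_of_eventuallyEq (Filter.Eventually.of_forall fun s => ?_)
    show τ + inner ℝ ξ _ = τ + ‖ξ‖ * inner ℝ e _
    rw [← real_inner_smul_left, ← hξe]
  have hint : IntegrableOn
      (fun s : ℝ => (ε ^ 2 + (τ + inner ℝ ξ (velocity (p + s • e))) ^ 2)⁻¹) (Icc 0 R) :=
    (hcont.comp hline).integrableOn_Icc
  rw [← ofReal_integral_eq_lintegral_ofReal hint (Filter.Eventually.of_forall fun s => by positivity)]
  refine ENNReal.ofReal_le_ofReal ?_
  rw [integral_Icc_eq_integral_Ioc, ← intervalIntegral.integral_of_le hR.le]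
  refine intervalIntegral_inv_sq_add_sq_le hR.le (by positivity) hε hd ?_ fun s hs => ?_
  · exact continuous_const.mul (continuous_const.mul
      (Continuous.inv₀ (by fun_prop) fun s => by positivity))
  -- By Cauchy–Schwarz the numerator `1 + |p|² - (e · p)²` is at least `1`; the segment stays in the
  -- ball of radius `2R + R = 3R`.
  · gcongr
    have h1 : inner ℝ e p ^ 2 ≤ ‖p‖ ^ 2 := by
      have := abs_real_inner_le_norm e p
      rw [he1, one_mul] at this
      exact sq_le_sq' (by linarith [neg_abs_le (inner ℝ e p)]) (le_of_abs_le this)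
    have h2 : ‖p + s • e‖ ≤ 3 * R := by
      refine (norm_add_le _ _).trans ?_
      rw [norm_smul, he1, mul_one, Real.norm_of_nonneg hs.1]
      rw [mem_ball_zero_iff] at hp
      linarith [hs.2]
    refine le_trans ?_ (le_mul_of_one_le_left (by positivity) (by linarith))
    gcongr

/-- The velocity averaging estimate: the resolvent kernel with `ε² = ⟨ζ⟩` gains half a power of
`⟨ζ⟩` after integration in momentum. -/
lemma exists_setLIntegral_kernel_le {R : ℝ} (hR : 0 < R) :
    ∃ C : ℝ, 0 ≤ C ∧ ∀ ζ : SpaceTime,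
      ∫⁻ p in Metric.ball 0 R,
        ENNReal.ofReal (bracket ζ / (bracket ζ + inner ℝ ζ (worldVelocity p) ^ 2)) ≤
      ENNReal.ofReal (C / √(bracket ζ)) := by
  set V : ℝ := (volume (Metric.ball (0 : E3) R)).toReal with hV
  set V' : ℝ := (volume (Metric.ball (0 : E3) (2 * R))).toReal with hV'
  have hVe : volume (Metric.ball (0 : E3) R) = ENNReal.ofReal V :=
    (ENNReal.ofReal_toReal measure_ball_lt_top.ne).symm
  have hVe' : volume (Metric.ball (0 : E3) (2 * R)) = ENNReal.ofReal V' :=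
    (ENNReal.ofReal_toReal measure_ball_lt_top.ne).symm
  have hV0 : 0 ≤ V := ENNReal.toReal_nonneg
  have hV0' : 0 ≤ V' := ENNReal.toReal_nonneg
  set c : ℝ := 1 - R / √(1 + R ^ 2) with hc
  have hc0 : 0 < c := by
    rw [hc, sub_pos, div_lt_one (by positivity)]
    exact Real.lt_sqrt_of_sq_lt (by linarith)
  have hc1 : c ≤ 1 := by
    rw [hc]; linarith [show 0 ≤ R / √(1 + R ^ 2) by positivity]
  set K : ℝ := R⁻¹ * (V' * (Real.pi * √(1 + (3 * R) ^ 2) ^ 3)) with hK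
  have hK0 : 0 ≤ K := by positivity
  -- One summand per regime: `|τ| ≥ |ξ|`, then `|τ| < |ξ| < 1`, then `|τ| < |ξ|` with `|ξ| ≥ 1`.
  refine ⟨2 * V / c ^ 2 + 2 * V + 2 * K, by positivity, fun ζ => ?_⟩
  set J := bracket ζ with hJ
  have hJ1 : 1 ≤ J := one_le_bracket ζ
  have hJ0 : 0 < J := by linarith
  have hJsq : J ^ 2 = 1 + ‖ζ‖ ^ 2 := bracket_sq ζ
  have hζ : ‖ζ‖ ^ 2 = ζ.fst ^ 2 + ‖ζ.snd‖ ^ 2 := by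
    rw [WithLp.prod_norm_sq_eq_of_L2]; simp
  have hs0 : 0 < √J := Real.sqrt_pos.2 hJ0
  have hssq : √J ^ 2 = J := Real.sq_sqrt hJ0.le
  have hs1 : 1 ≤ √J := Real.one_le_sqrt.2 hJ1
  have hconst : ∀ B : ℝ, (∀ p ∈ Metric.ball (0 : E3) R,
      J / (J + inner ℝ ζ (worldVelocity p) ^ 2) ≤ B) →
      ∫⁻ p in Metric.ball 0 R, ENNReal.ofReal (J / (J + inner ℝ ζ (worldVelocity p) ^ 2)) ≤
        ENNReal.ofReal (V * B) := fun B hB => by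
    calc _ ≤ ∫⁻ p in Metric.ball (0 : E3) R, ENNReal.ofReal B :=
          setLIntegral_mono measurable_const fun p hp => ENNReal.ofReal_le_ofReal (hB p hp)
      _ = _ := by rw [setLIntegral_const, hVe, ENNReal.ofReal_mul hV0, mul_comm]
  -- If `|τ| ≥ |ξ|`, then `|b| ≥ c |τ|` and the kernel is pointwise `O(1/⟨ζ⟩)`. Otherwise `⟨ζ⟩ ≤
  -- 2|ξ|` for `|ξ| ≥ 1`, where the resolvent bound with `ε = √⟨ζ⟩` applies; for `|ξ| < 1` the
  -- bracket is at most `2` and the trivial bound is enough.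
  rcases le_or_gt ‖ζ.snd‖ |ζ.fst| with hcase | hcase
  · refine (hconst (2 / c ^ 2 / √J) fun p hp => ?_).trans (ENNReal.ofReal_le_ofReal ?_)
    · have hb : c * |ζ.fst| ≤ |inner ℝ ζ (worldVelocity p)| := by
        rw [inner_worldVelocity]
        have h1 : |inner ℝ ζ.snd (velocity p)| ≤ |ζ.fst| * (1 - c) :=
          (abs_real_inner_le_norm _ _).trans (by
            have := norm_velocity_le_of_mem_ball hp
            have h2 : 1 - c = R / √(1 + R ^ 2) := by rw [hc]; ring
            rw [h2]
            gcongr)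
        have h3 := abs_sub_abs_le_abs_sub ζ.fst (-inner ℝ ζ.snd (velocity p))
        rw [abs_neg, sub_neg_eq_add] at h3
        linarith
      have hb2 : c ^ 2 * ζ.fst ^ 2 ≤ inner ℝ ζ (worldVelocity p) ^ 2 := by
        rw [← sq_abs ζ.fst, ← sq_abs (inner ℝ ζ _), ← mul_pow]
        gcongr
      have h4 : ‖ζ.snd‖ ^ 2 ≤ ζ.fst ^ 2 := by
        rw [← sq_abs ζ.fst]; gcongr
      rw [div_div, div_le_div_iff₀ (by positivity) (by positivity)]
      have h5 : c ^ 2 * J ^ 2 ≤ 2 * (J + inner ℝ ζ (worldVelocity p) ^ 2) := by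
        have hcc : c ^ 2 ≤ 1 := by nlinarith
        rw [hJsq, hζ]
        nlinarith [mul_le_mul_of_nonneg_left h4 (sq_nonneg c)]
      have h6 : √J ≤ J := by nlinarith
      calc J * (c ^ 2 * √J) ≤ J * (c ^ 2 * J) := by gcongr
        _ = c ^ 2 * J ^ 2 := by ring
        _ ≤ _ := h5
    · rw [← mul_div_assoc, ← mul_div_assoc]
      gcongr
      rw [mul_comm V 2]
      nlinarith
  · have hsnd : 0 < ‖ζ.snd‖ := (abs_nonneg _).trans_lt hcase
    have h4 : ζ.fst ^ 2 ≤ ‖ζ.snd‖ ^ 2 := by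
      rw [← sq_abs ζ.fst]; gcongr
    rcases le_or_gt 1 ‖ζ.snd‖ with h1 | h1
    · have hJle : J ≤ 2 * ‖ζ.snd‖ := by
        refine le_of_sq_le_sq ?_ (by positivity)
        rw [hJsq, hζ]; nlinarith
      have hbound := setLIntegral_resolvent_le hR (τ := ζ.fst) hs0 (norm_pos_iff.1 hsnd)
      have heq : ∫⁻ p in Metric.ball 0 R,
          ENNReal.ofReal (J / (J + inner ℝ ζ (worldVelocity p) ^ 2)) =
          ENNReal.ofReal J * ∫⁻ p in Metric.ball 0 R,
            ENNReal.ofReal ((√J ^ 2 + (ζ.fst + inner ℝ ζ.snd (velocity p)) ^ 2)⁻¹) := by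
        rw [← lintegral_const_mul' _ _ ENNReal.ofReal_ne_top]
        refine lintegral_congr fun p => ?_
        rw [← ENNReal.ofReal_mul hJ0.le, inner_worldVelocity, hssq, div_eq_mul_inv]
      rw [heq]
      refine (mul_le_mul_right hbound _).trans ?_
      rw [hVe', ← ENNReal.ofReal_inv_of_pos hR, ← ENNReal.ofReal_mul hV0',
        ← ENNReal.ofReal_mul (by positivity), ← ENNReal.ofReal_mul hJ0.le]
      refine ENNReal.ofReal_le_ofReal ?_
      have h7 : J * (R⁻¹ * (V' * (Real.pi / (‖ζ.snd‖ * (√(1 + (3 * R) ^ 2) ^ 3)⁻¹ * √J))))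
          = K * (J / ‖ζ.snd‖) / √J := by
        rw [hK]; field_simp
      rw [h7]
      gcongr
      have h8 : J / ‖ζ.snd‖ ≤ 2 := by rwa [div_le_iff₀ hsnd]
      have : 0 ≤ 2 * V / c ^ 2 := by positivity
      nlinarith
    · refine (hconst (2 / √J) fun p hp => ?_).trans (ENNReal.ofReal_le_ofReal ?_)
      · have hJle : J ≤ 2 := by
          refine le_of_sq_le_sq ?_ (by positivity)
          rw [hJsq, hζ]; nlinarith
        rw [div_le_div_iff₀ (by positivity) hs0]
        have : √J ≤ 2 := by nlinarith
        nlinarith [sq_nonneg (inner ℝ ζ (worldVelocity p))]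
      · rw [← mul_div_assoc]
        gcongr
        have : 0 ≤ 2 * V / c ^ 2 := by positivity
        linarith

/-! ### Smoothness of integrals depending on a parameter -/

section ParametricIntegral

variable {Q V : Type*} [NormedAddCommGroup Q] [NormedSpace ℝ Q]
  [NormedAddCommGroup V] [NormedSpace ℝ V] [MeasurableSpace V]
  [BorelSpace V] {μ : Measure V} [μ.IsAddHaarMeasure]

/-- The integral is the convolution of the constant `1` with `ζ ↦ G (q, -ζ)` evaluated at `0`, so
smoothness of convolutions with a parameter applies. -/
lemma contDiff_integral_of_forall_notMem_eq_zero [FiniteDimensional ℝ V] {G : Q × V → ℂ}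
    (hG : ContDiff ℝ (⊤ : ℕ∞) G) {K : Set V} (hK : IsCompact K) (hGK : ∀ q ζ, ζ ∉ K → G (q, ζ) = 0) :
    ContDiff ℝ (⊤ : ℕ∞) fun q => ∫ ζ, G (q, ζ) ∂μ := by
  have hsmooth : ContDiff ℝ (⊤ : ℕ∞) ↿(fun (q : Q) (ζ : V) => G (q, -ζ)) :=
    hG.comp (contDiff_fst.prodMk contDiff_snd.neg)
  have h := contDiffOn_convolution_right_with_param (μ := μ) (f := fun _ : V => (1 : ℝ))
    (ContinuousLinearMap.lsmul ℝ ℝ) (n := ⊤) (g := fun (q : Q) (ζ : V) => G (q, -ζ))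
    (s := univ) (k := -K) isOpen_univ hK.neg
    (fun q ζ _ hζ => hGK q _ (by simpa using hζ)) (locallyIntegrable_const _) hsmooth.contDiffOn
  rw [univ_prod_univ, contDiffOn_univ] at h
  have h2 := h.comp (contDiff_id.prodMk (contDiff_const (c := (0 : V))) : ContDiff ℝ _
    fun q : Q => (q, (0 : V)))
  convert h2 using 2 with q
  simp [convolution_def]

/-- Dominated differentiation: the partial derivative is bounded on the compact set `closedBall q 1
×ˢ K` and vanishes for `ζ ∉ K`, so a multiple of the indicator of `K` dominates. -/
lemma hasFDerivAt_integral_of_forall_notMem_eq_zero [FiniteDimensional ℝ Q] {G : Q × V → ℂ}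
    (hG : ContDiff ℝ (⊤ : ℕ∞) G) {K : Set V} (hK : IsCompact K)
    (hGK : ∀ q ζ, ζ ∉ K → G (q, ζ) = 0) (q : Q) :
    HasFDerivAt (fun q => ∫ ζ, G (q, ζ) ∂μ)
      (∫ ζ, (fderiv ℝ G (q, ζ)).comp (ContinuousLinearMap.inl ℝ Q V) ∂μ) q ∧
    Integrable (fun ζ => (fderiv ℝ G (q, ζ)).comp (ContinuousLinearMap.inl ℝ Q V)) μ := by
  have hd : ∀ q ζ, HasFDerivAt (fun q => G (q, ζ))
      ((fderiv ℝ G (q, ζ)).comp (ContinuousLinearMap.inl ℝ Q V)) q := fun q ζ =>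
    ((hG.differentiable (by simp)) (q, ζ)).hasFDerivAt.comp q (hasFDerivAt_prodMk_left q ζ)
  have hcont : Continuous fun y : Q × V =>
      (fderiv ℝ G y).comp (ContinuousLinearMap.inl ℝ Q V) :=
    (hG.continuous_fderiv (by simp)).clm_comp continuous_const
  have hzero : ∀ q ζ, ζ ∉ K →
      (fderiv ℝ G (q, ζ)).comp (ContinuousLinearMap.inl ℝ Q V) = 0 := fun q ζ hζ => by
    refine (hd q ζ).unique ?_
    simp_rw [hGK _ ζ hζ]
    exact hasFDerivAt_const _ _
  have : ProperSpace Q := FiniteDimensional.proper_real Q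
  obtain ⟨B, hB⟩ := (((isCompact_closedBall q 1).prod hK).image hcont).isBounded.exists_norm_le
  have hint := (hcont.comp (Continuous.prodMk_right q)).integrable_of_hasCompactSupport
    (μ := μ) (HasCompactSupport.intro hK (hzero q))
  refine ⟨hasFDerivAt_integral_of_dominated_of_fderiv_le (μ := μ) (F := fun q ζ => G (q, ζ))
    (F' := fun q ζ => (fderiv ℝ G (q, ζ)).comp (ContinuousLinearMap.inl ℝ Q V))
    (bound := K.indicator fun _ => B)
    (Metric.closedBall_mem_nhds q one_pos) (Filter.Eventually.of_forall fun q => ?_)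
    ((hG.continuous.comp (Continuous.prodMk_right q)).integrable_of_hasCompactSupport
      (HasCompactSupport.intro hK (hGK q))) hint.aestronglyMeasurable
    (Filter.Eventually.of_forall fun ζ q' hq' => ?_) ?_
    (Filter.Eventually.of_forall fun ζ q' _ => hd q' ζ), hint⟩
  · exact (hG.continuous.comp (Continuous.prodMk_right q)).aestronglyMeasurable
  · by_cases hζ : ζ ∈ K
    · rw [indicator_of_mem hζ]
      exact hB _ ⟨(q', ζ), ⟨hq', hζ⟩, rfl⟩
    · rw [hzero q' ζ hζ, indicator_of_notMem hζ, norm_zero]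
  · rw [integrable_indicator_iff hK.measurableSet]
    exact integrableOn_const hK.measure_lt_top.ne

lemma fderiv_integral_of_forall_notMem_eq_zero [FiniteDimensional ℝ Q] {G : Q × V → ℂ}
    (hG : ContDiff ℝ (⊤ : ℕ∞) G) {K : Set V} (hK : IsCompact K)
    (hGK : ∀ q ζ, ζ ∉ K → G (q, ζ) = 0) (q v : Q) :
    fderiv ℝ (fun q => ∫ ζ, G (q, ζ) ∂μ) q v = ∫ ζ, fderiv ℝ G (q, ζ) (v, 0) ∂μ := by
  obtain ⟨h, hi⟩ := hasFDerivAt_integral_of_forall_notMem_eq_zero (μ := μ) hG hK hGK q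
  rw [h.fderiv, ContinuousLinearMap.integral_apply hi]
  simp

end ParametricIntegral

/-! ### Cauchy–Schwarz and Plancherel -/

section L2

variable {α F : Type*} [MeasurableSpace α] [NormedAddCommGroup F]

lemma eLpNorm_two_sq (f : α → F) (μ : Measure α) :
    eLpNorm f 2 μ ^ 2 = ∫⁻ x, ‖f x‖ₑ ^ 2 ∂μ := by
  have h := eLpNorm_nnreal_pow_eq_lintegral (μ := μ) (f := f) (p := 2) two_ne_zero
  simpa using h

lemma enorm_integral_mul_le_eLpNorm_two {μ : Measure α} {f g : α → ℂ}
    (hf : AEStronglyMeasurable f μ) (hg : AEStronglyMeasurable g μ) :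
    ‖∫ x, f x * g x ∂μ‖ₑ ≤ eLpNorm f 2 μ * eLpNorm g 2 μ := by
  refine (enorm_integral_le_lintegral_enorm _).trans ?_
  rw [← eLpNorm_one_eq_lintegral_enorm]
  exact eLpNorm_smul_le_mul_eLpNorm (φ := f) (f := g) (p := 2) (q := 2) (r := 1) hg hf

end L2

lemma eLpNorm_fourier_eq {V : Type*} [NormedAddCommGroup V] [InnerProductSpace ℝ V]
    [FiniteDimensional ℝ V] [MeasurableSpace V] [BorelSpace V] {f : V → ℂ}
    (hf : ContDiff ℝ (⊤ : ℕ∞) f) (hc : HasCompactSupport f) :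
    eLpNorm (𝓕 f) 2 volume = eLpNorm f 2 volume := by
  have h := SchwartzMap.norm_fourier_toL2_eq (hc.toSchwartzMap hf)
  rw [SchwartzMap.norm_toLp, SchwartzMap.norm_toLp, ENNReal.toReal_eq_toReal_iff'
    (SchwartzMap.memLp _ _ _).eLpNorm_ne_top (SchwartzMap.memLp _ _ _).eLpNorm_ne_top,
    SchwartzMap.fourier_coe] at h
  exact h

/-! ### Fourier transform in space-time with momentum as a parameter -/

/-- The Fourier transform in the space-time variable with the momentum as a parameter. -/
noncomputable def partialFourier (σ : SpaceTime × E3 → ℂ) (y : SpaceTime × E3) : ℂ :=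
  𝓕 (fun ζ => σ (ζ, y.2)) y.1

section PartialFourier

variable {σ : SpaceTime × E3 → ℂ} {K : Set SpaceTime}

/-- The integrand of the partial Fourier transform. -/
noncomputable def phaseIntegrand (σ : SpaceTime × E3 → ℂ) (Y : (SpaceTime × E3) × SpaceTime) : ℂ :=
  Complex.exp (((-2 * Real.pi * inner ℝ Y.2 Y.1.1 : ℝ) : ℂ) * Complex.I) * σ (Y.2, Y.1.2)

lemma partialFourier_eq_integral (σ : SpaceTime × E3 → ℂ) (y : SpaceTime × E3) :
    partialFourier σ y = ∫ ζ, phaseIntegrand σ (y, ζ) := by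
  simp [partialFourier, phaseIntegrand, Real.fourier_eq']

lemma contDiff_phaseIntegrand (hσ : ContDiff ℝ (⊤ : ℕ∞) σ) :
    ContDiff ℝ (⊤ : ℕ∞) (phaseIntegrand σ) := by
  unfold phaseIntegrand
  have h1 : ContDiff ℝ (⊤ : ℕ∞) fun Y : (SpaceTime × E3) × SpaceTime =>
      (-2 * Real.pi * inner ℝ Y.2 Y.1.1 : ℝ) :=
    contDiff_const.mul (contDiff_snd.inner ℝ (contDiff_fst.comp contDiff_fst))
  have h2 : ContDiff ℝ (⊤ : ℕ∞) fun Y : (SpaceTime × E3) × SpaceTime => (Y.2, Y.1.2) :=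
    contDiff_snd.prodMk (contDiff_snd.comp contDiff_fst)
  exact (((Complex.ofRealCLM.contDiff.comp h1).mul contDiff_const).cexp).mul (hσ.comp h2)

lemma phaseIntegrand_eq_zero (hσK : ∀ ζ p, ζ ∉ K → σ (ζ, p) = 0) (y : SpaceTime × E3)
    (ζ : SpaceTime) (hζ : ζ ∉ K) : phaseIntegrand σ (y, ζ) = 0 := by
  simp [phaseIntegrand, hσK ζ _ hζ]

lemma contDiff_partialFourier (hσ : ContDiff ℝ (⊤ : ℕ∞) σ) (hK : IsCompact K)
    (hσK : ∀ ζ p, ζ ∉ K → σ (ζ, p) = 0) : ContDiff ℝ (⊤ : ℕ∞) (partialFourier σ) := by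
  rw [funext (partialFourier_eq_integral σ)]
  exact contDiff_integral_of_forall_notMem_eq_zero (contDiff_phaseIntegrand hσ) hK
    (phaseIntegrand_eq_zero hσK)

lemma fderiv_partialFourier_eq_integral (hσ : ContDiff ℝ (⊤ : ℕ∞) σ) (hK : IsCompact K)
    (hσK : ∀ ζ p, ζ ∉ K → σ (ζ, p) = 0) (y v : SpaceTime × E3) :
    fderiv ℝ (partialFourier σ) y v = ∫ ζ, fderiv ℝ (phaseIntegrand σ) (y, ζ) (v, 0) := by
  rw [funext (partialFourier_eq_integral σ)]
  exact fderiv_integral_of_forall_notMem_eq_zero (contDiff_phaseIntegrand hσ) hK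
    (phaseIntegrand_eq_zero hσK) y v

/-- Restricting to a line reduces this to the one-variable product rule: `v` only moves the
exponential and `e` only moves the symbol. -/
lemma fderiv_phaseIntegrand (hσ : ContDiff ℝ (⊤ : ℕ∞) σ) (y : SpaceTime × E3) (ζ : SpaceTime)
    (v : SpaceTime) (e : E3) :
    fderiv ℝ (phaseIntegrand σ) (y, ζ) ((v, e), 0) =
      Complex.exp (((-2 * Real.pi * inner ℝ ζ y.1 : ℝ) : ℂ) * Complex.I) *
        (((-2 * Real.pi * inner ℝ ζ v : ℝ) : ℂ) * Complex.I * σ (ζ, y.2) +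
          fderiv ℝ σ (ζ, y.2) (0, e)) := by
  have hd : HasFDerivAt (phaseIntegrand σ) (fderiv ℝ (phaseIntegrand σ) (y, ζ)) (y, ζ) :=
    (((contDiff_phaseIntegrand hσ).differentiable (by simp)) _).hasFDerivAt
  have hline : HasDerivAt (fun s : ℝ => ((y, ζ) : (SpaceTime × E3) × SpaceTime) + s • ((v, e), 0))
      ((v, e), 0) 0 := by
    simpa using ((hasDerivAt_id (0 : ℝ)).smul_const (((v, e), 0) :
      (SpaceTime × E3) × SpaceTime)).const_add (y, ζ)
  have h1 := HasFDerivAt.comp_hasDerivAt_of_eq (0 : ℝ) hd hline (by simp)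
  refine h1.unique ?_
  have hσd : HasFDerivAt σ (fderiv ℝ σ (ζ, y.2)) (ζ, y.2) :=
    ((hσ.differentiable (by simp)) _).hasFDerivAt
  have hline2 : HasDerivAt (fun s : ℝ => ((ζ, y.2) : SpaceTime × E3) + s • (0, e)) (0, e) 0 := by
    simpa using ((hasDerivAt_id (0 : ℝ)).smul_const ((0, e) : SpaceTime × E3)).const_add (ζ, y.2)
  have h2 := HasFDerivAt.comp_hasDerivAt_of_eq (0 : ℝ) hσd hline2 (by simp)
  have h3 : HasDerivAt (fun s : ℝ => (-2 * Real.pi * (inner ℝ ζ y.1 + s * inner ℝ ζ v) : ℝ))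
      (-2 * Real.pi * inner ℝ ζ v) 0 := by
    simpa using (((hasDerivAt_id (0 : ℝ)).mul_const (inner ℝ ζ v)).const_add
      (inner ℝ ζ y.1)).const_mul (-2 * Real.pi)
  have h4 := ((h3.ofReal_comp.mul_const Complex.I).cexp).mul h2
  refine (h4.congr_deriv ?_).congr_of_eventuallyEq (Filter.Eventually.of_forall fun s => ?_)
  · simp
    ring
  · simp [phaseIntegrand, inner_add_right, inner_smul_right]

lemma fderiv_partialFourier_left (hσ : ContDiff ℝ (⊤ : ℕ∞) σ) (hK : IsCompact K)
    (hσK : ∀ ζ p, ζ ∉ K → σ (ζ, p) = 0) (y : SpaceTime × E3) (v : SpaceTime) :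
    fderiv ℝ (partialFourier σ) y (v, 0) =
      𝓕 (fun ζ => ((-2 * Real.pi * inner ℝ ζ v : ℝ) : ℂ) * Complex.I * σ (ζ, y.2)) y.1 := by
  rw [fderiv_partialFourier_eq_integral hσ hK hσK, Real.fourier_eq']
  refine integral_congr_ae (Filter.Eventually.of_forall fun ζ => ?_)
  have h := fderiv_phaseIntegrand hσ y ζ v 0
  rw [show ((0 : SpaceTime), (0 : E3)) = 0 from rfl, map_zero, add_zero] at h
  exact h

lemma fderiv_partialFourier_right (hσ : ContDiff ℝ (⊤ : ℕ∞) σ) (hK : IsCompact K)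
    (hσK : ∀ ζ p, ζ ∉ K → σ (ζ, p) = 0) (y : SpaceTime × E3) (e : E3) :
    fderiv ℝ (partialFourier σ) y (0, e) =
      partialFourier (fun y => fderiv ℝ σ y (0, e)) y := by
  rw [fderiv_partialFourier_eq_integral hσ hK hσK, partialFourier_eq_integral]
  refine integral_congr_ae (Filter.Eventually.of_forall fun ζ => ?_)
  have h := fderiv_phaseIntegrand hσ y ζ 0 e
  rw [inner_zero_right, mul_zero, Complex.ofReal_zero, zero_mul, zero_mul, zero_add] at h
  exact h

lemma contDiff_fderiv_right (hσ : ContDiff ℝ (⊤ : ℕ∞) σ) (e : E3) :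
    ContDiff ℝ (⊤ : ℕ∞) fun y => fderiv ℝ σ y (0, e) :=
  (hσ.fderiv_right (m := (⊤ : ℕ∞)) (by simp)).clm_apply contDiff_const

lemma phaseMeasure_eq_prod (R : ℝ) :
    phaseMeasure R = (volume : Measure SpaceTime).prod
      ((volume : Measure E3).restrict (Metric.ball 0 R)) := by
  rw [phaseMeasure, phaseDomain, Measure.volume_eq_prod]
  simp only [Opens.coe_mk]
  rw [← Measure.prod_restrict, Measure.restrict_univ]

/-- Plancherel's theorem for the partial Fourier transform of a symbol `θ(ζ) m(ζ, p)`, with an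
upper bound for the momentum integral of `|m|²`. -/
lemma eLpNorm_partialFourier_le {R : ℝ} {A : SpaceTime → ℝ≥0∞} {θ : SpaceTime → ℂ}
    {m : SpaceTime × E3 → ℂ} (hσ : ContDiff ℝ (⊤ : ℕ∞) fun y : SpaceTime × E3 => θ y.1 * m y)
    (hK : IsCompact K) (hθK : ∀ ζ, ζ ∉ K → θ ζ = 0)
    (hm : ∀ ζ, ∫⁻ p in Metric.ball 0 R, ‖m (ζ, p)‖ₑ ^ 2 ≤ A ζ) :
    eLpNorm (partialFourier fun y => θ y.1 * m y) 2 (phaseMeasure R) ^ 2 ≤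
      ∫⁻ ζ, ‖θ ζ‖ₑ ^ 2 * A ζ := by
  set σ : SpaceTime × E3 → ℂ := fun y => θ y.1 * m y with hσd
  have hσK : ∀ ζ p, ζ ∉ K → σ (ζ, p) = 0 := fun ζ p hζ => by simp [hσd, hθK ζ hζ]
  have hF : Continuous (partialFourier σ) := (contDiff_partialFourier hσ hK hσK).continuous
  rw [eLpNorm_two_sq, phaseMeasure_eq_prod, lintegral_prod_symm' _ (by fun_prop)]
  have hpl : ∀ p, ∫⁻ z, ‖partialFourier σ (z, p)‖ₑ ^ 2 = ∫⁻ ζ, ‖σ (ζ, p)‖ₑ ^ 2 := fun p => by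
    have h := eLpNorm_fourier_eq (f := fun ζ => σ (ζ, p))
      (hσ.comp (contDiff_id.prodMk contDiff_const)) (HasCompactSupport.intro hK fun ζ => hσK ζ p)
    rw [← eLpNorm_two_sq, ← eLpNorm_two_sq (fun ζ => σ (ζ, p)), ← h]
    rfl
  simp_rw [hpl]
  have hσc : Continuous σ := hσ.continuous
  rw [lintegral_lintegral_swap 
    ((hσc.comp continuous_swap).enorm.measurable.pow_const 2).aemeasurable]
  refine lintegral_mono fun ζ => ?_
  simp_rw [hσd, enorm_mul, mul_pow]
  rw [lintegral_const_mul' _ _ (by simp)]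
  gcongr
  exact hm ζ

end PartialFourier

/-! ### The transport operator and the enlarged class of test functions -/

/-- The transport operator `∂_t + p̂ · ∂_x`. -/
noncomputable def transport (φ : SpaceTime × E3 → ℂ) (y : SpaceTime × E3) : ℂ :=
  fderiv ℝ φ y (worldVelocity y.2, 0)

lemma partialT_add_sum_partialX (φ : SpaceTime × E3 → ℂ) (y : SpaceTime × E3) :
    partialT φ y + ∑ i, (velocity y.2 i : ℂ) * partialX i φ y = transport φ y := by
  have hv : ((worldVelocity y.2, 0) : SpaceTime × E3) =
      (WithLp.toLp 2 (1, 0), 0) +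
        ∑ i, velocity y.2 i • ((WithLp.toLp 2 (0, EuclideanSpace.single i 1), 0) :
          SpaceTime × E3) := by
    refine Prod.ext ?_ (by simp [Prod.snd_sum])
    refine WithLp.ofLp_injective 2 (Prod.ext ?_ ?_)
    · simp [worldVelocity, Prod.fst_sum, WithLp.ofLp_sum]
    · ext j
      simp [worldVelocity, Prod.fst_sum, Prod.snd_sum, WithLp.ofLp_sum, Pi.single_apply]
  rw [transport, hv, map_add, map_sum]
  simp_rw [map_smul]
  simp only [partialT, partialX, Complex.real_smul]

lemma norm_velocity_le_one (p : E3) : ‖velocity p‖ ≤ 1 := by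
  refine (norm_velocity_le_of_mem_ball (R := ‖p‖ + 1) (by simp)).trans ?_
  refine (div_le_one (by positivity)).2 (Real.le_sqrt_of_sq_le (by linarith))

lemma norm_worldVelocity_le (p : E3) : ‖worldVelocity p‖ ≤ 2 := by
  refine le_of_sq_le_sq ?_ (by norm_num)
  rw [worldVelocity, WithLp.prod_norm_sq_eq_of_L2]
  have h1 := norm_velocity_le_one p
  have h2 := norm_nonneg (velocity p)
  simp
  nlinarith

section Cutoff

variable (χ : ContDiffBump (0 : SpaceTime)) (a : ℝ) (Φ : SpaceTime × E3 → ℂ)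

/-- Multiplication by a cutoff `χ(a z)` in space-time. -/
noncomputable def cutoff (y : SpaceTime × E3) : ℂ := (χ (a • y.1) : ℂ) * Φ y

variable {Φ}

lemma contDiff_cutoff (hΦ : ContDiff ℝ (⊤ : ℕ∞) Φ) : ContDiff ℝ (⊤ : ℕ∞) (cutoff χ a Φ) := by
  have h1 : ContDiff ℝ (⊤ : ℕ∞) fun y : SpaceTime × E3 => χ (a • y.1) :=
    χ.contDiff.comp (contDiff_fst.const_smul a)
  exact (Complex.ofRealCLM.contDiff.comp h1).mul hΦ

lemma fderiv_cutoff (hΦ : ContDiff ℝ (⊤ : ℕ∞) Φ) (y v : SpaceTime × E3) :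
    fderiv ℝ (cutoff χ a Φ) y v =
      (χ (a • y.1) : ℂ) * fderiv ℝ Φ y v + ((a * fderiv ℝ χ (a • y.1) v.1 : ℝ) : ℂ) * Φ y := by
  have h1 : HasFDerivAt (fun y : SpaceTime × E3 => a • y.1)
      (a • ContinuousLinearMap.fst ℝ SpaceTime E3) y := hasFDerivAt_fst.const_smul a
  have h2 : HasFDerivAt χ (fderiv ℝ χ (a • y.1)) (a • y.1) :=
    ((χ.contDiff (n := 1)).differentiable (by simp) _).hasFDerivAt
  have h3 := Complex.ofRealCLM.hasFDerivAt.comp y (h2.comp y h1)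
  have h4 := h3.mul ((hΦ.differentiable (by simp)) y).hasFDerivAt
  have h5 : HasFDerivAt (cutoff χ a Φ) _ y := h4
  rw [h5.fderiv]
  simp [mul_comm]

lemma cutoff_eq_zero (ha : 0 < a) {K : Set E3} (hΦK : ∀ z p, p ∉ K → Φ (z, p) = 0)
    (y : SpaceTime × E3) (hy : y ∉ Metric.closedBall (0 : SpaceTime) (χ.rOut / a) ×ˢ K) :
    cutoff χ a Φ y = 0 := by
  rw [cutoff]
  by_cases hp : y.2 ∈ K
  · rw [χ.zero_of_le_dist, Complex.ofReal_zero, zero_mul]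
    by_contra! hlt
    refine hy ⟨?_, hp⟩
    rw [dist_zero_right, norm_smul, Real.norm_of_nonneg ha.le] at hlt
    rw [mem_closedBall_zero_iff, le_div_iff₀ ha]
    linarith
  · rw [hΦK y.1 y.2 hp, mul_zero]

/-- The cutoff of a smooth function that is supported in a compact set of momenta is a test
function. -/
noncomputable def cutoffTestFunction {R : ℝ} (ha : 0 < a) (hΦ : ContDiff ℝ (⊤ : ℕ∞) Φ) {K : Set E3}
    (hK : IsCompact K) (hKR : K ⊆ Metric.ball 0 R) (hΦK : ∀ z p, p ∉ K → Φ (z, p) = 0) :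
    𝓓(phaseDomain R, ℂ) where
  toFun := cutoff χ a Φ
  contDiff' := contDiff_cutoff χ a hΦ
  hasCompactSupport' := HasCompactSupport.intro ((isCompact_closedBall _ _).prod hK)
    (cutoff_eq_zero χ a ha hΦK)
  tsupport_subset' := by
    refine (closure_minimal (t := Metric.closedBall (0 : SpaceTime) (χ.rOut / a) ×ˢ K) ?_
      (Metric.isClosed_closedBall.prod hK.isClosed)).trans (prod_mono (subset_univ _) hKR)
    intro y hy
    by_contra hn
    exact hy (cutoff_eq_zero χ a ha hΦK y hn)

end Cutoff

lemma integrable_mul_of_memLp_two {α : Type*} [MeasurableSpace α] {μ : Measure α} {f g : α → ℂ}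
    (hf : MemLp f 2 μ) (hg : MemLp g 2 μ) : Integrable (fun x => f x * g x) μ :=
  hf.integrable_mul hg

lemma memLp_coord {α : Type*} [MeasurableSpace α] {μ : Measure α}
    {g : α → EuclideanSpace ℂ (Fin 3)} (hg : MemLp g 2 μ) (i : Fin 3) :
    MemLp (fun x => g x i) 2 μ :=
  (EuclideanSpace.proj (𝕜 := ℂ) i).comp_memLp' hg

/-- The weak formulation extends to test functions which are compactly supported in momentum but
only square integrable in space-time. -/
lemma IsDistribSolution.integral_transport_eq {R : ℝ} {h g₀ : SpaceTime × E3 → ℂ}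
    {g₁ : SpaceTime × E3 → EuclideanSpace ℂ (Fin 3)} (hsol : IsDistribSolution R h g₀ g₁)
    (hh : MemLp h 2 (phaseMeasure R)) (hg₀ : MemLp g₀ 2 (phaseMeasure R))
    (hg₁ : MemLp g₁ 2 (phaseMeasure R)) {Φ : SpaceTime × E3 → ℂ} (hΦ : ContDiff ℝ (⊤ : ℕ∞) Φ)
    {K : Set E3} (hK : IsCompact K) (hKR : K ⊆ Metric.ball 0 R)
    (hΦK : ∀ z p, p ∉ K → Φ (z, p) = 0) (hL : MemLp Φ 2 (phaseMeasure R))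
    (hLT : MemLp (transport Φ) 2 (phaseMeasure R))
    (hLP : ∀ i, MemLp (partialP i Φ) 2 (phaseMeasure R)) :
    -∫ y, h y * transport Φ y ∂(phaseMeasure R) =
      ∫ y, g₀ y * Φ y ∂(phaseMeasure R) -
        ∑ i, ∫ y, g₁ y i * partialP i Φ y ∂(phaseMeasure R) := by
  obtain ⟨χ⟩ : Nonempty (ContDiffBump (0 : SpaceTime)) := ⟨⟨1, 2, one_pos, one_lt_two⟩⟩
  have hχc : Continuous (fderiv ℝ χ) := (χ.contDiff (n := 1)).continuous_fderiv (by simp)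
  obtain ⟨B, hB⟩ := hχc.bounded_above_of_compact_support (χ.hasCompactSupport.fderiv ℝ)
  have hB0 : 0 ≤ B := (norm_nonneg _).trans (hB 0)
  -- The cutoffs `χ(a n • z)` increase to all of space-time. They do not depend on `p`, so `∂_p`
  -- commutes with them; their transport derivative is at most `2 B a n`, the `2` bounding the
  -- length of `(1, p̂)`, and disappears in the limit.
  set a : ℕ → ℝ := fun n => 1 / ((n : ℝ) + 1) with ha
  have ha0 : ∀ n, 0 < a n := fun n => by positivity
  have ha1 : ∀ n, a n ≤ 1 := fun n => by
    rw [ha]; simp only; rw [div_le_one (by positivity)]; linarith [n.cast_nonneg (α := ℝ)]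
  have hat : Tendsto a atTop (𝓝 0) := tendsto_one_div_add_atTop_nhds_zero_nat
  have hχt : ∀ z : SpaceTime, Tendsto (fun n => (χ (a n • z) : ℂ)) atTop (𝓝 1) := fun z => by
    have h1 : Tendsto (fun n => χ (a n • z)) atTop (𝓝 (χ ((0 : ℝ) • z))) :=
      (χ.continuous.tendsto _).comp (hat.smul_const z)
    rw [zero_smul, χ.one_of_mem_closedBall (by simp [χ.rIn_pos.le])] at h1
    exact_mod_cast (Complex.continuous_ofReal.tendsto 1).comp h1
  have hχ1 : ∀ (n : ℕ) (z : SpaceTime), ‖(χ (a n • z) : ℂ)‖ ≤ 1 := fun n z => by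
    rw [Complex.norm_real, Real.norm_of_nonneg χ.nonneg]
    exact χ.le_one
  have hcoef : ∀ (n : ℕ) (y : SpaceTime × E3),
      |a n * fderiv ℝ χ (a n • y.1) (worldVelocity y.2)| ≤ a n * (B * 2) := fun n y => by
    rw [abs_mul, abs_of_pos (ha0 n)]
    refine mul_le_mul_of_nonneg_left ?_ (ha0 n).le
    refine ((fderiv ℝ χ (a n • y.1)).le_opNorm _).trans ?_
    have := hB (a n • y.1)
    have := norm_worldVelocity_le y.2
    gcongr
  have hT : ∀ n y, transport (cutoff χ (a n) Φ) y = (χ (a n • y.1) : ℂ) * transport Φ y +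
      ((a n * fderiv ℝ χ (a n • y.1) (worldVelocity y.2) : ℝ) : ℂ) * Φ y := fun n y =>
    fderiv_cutoff χ (a n) hΦ y _
  have hP : ∀ n i y, partialP i (cutoff χ (a n) Φ) y =
      (χ (a n • y.1) : ℂ) * partialP i Φ y := fun n i y => by
    rw [partialP, fderiv_cutoff χ (a n) hΦ]
    simp [partialP]
  have hχm : ∀ n, Continuous fun y : SpaceTime × E3 => (χ (a n • y.1) : ℂ) := fun n =>
    Complex.continuous_ofReal.comp (χ.continuous.comp (by fun_prop))
  have hwc := contDiff_worldVelocity.continuous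
  have hcm : ∀ n, Continuous fun y : SpaceTime × E3 =>
      ((a n * fderiv ℝ χ (a n • y.1) (worldVelocity y.2) : ℝ) : ℂ) := fun n =>
    Complex.continuous_ofReal.comp (continuous_const.mul
      ((hχc.comp (by fun_prop)).clm_apply (by fun_prop)))
  have hlim1 : Tendsto (fun n => ∫ y, h y * transport (cutoff χ (a n) Φ) y ∂(phaseMeasure R)) atTop
      (𝓝 (∫ y, h y * transport Φ y ∂(phaseMeasure R))) := by
    refine tendsto_integral_of_dominated_convergence
      (fun y => ‖h y * transport Φ y‖ + B * 2 * ‖h y * Φ y‖) (fun n => ?_)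
      ((integrable_mul_of_memLp_two hh hLT).norm.add
        ((integrable_mul_of_memLp_two hh hL).norm.const_mul _)) (fun n => ?_) ?_
    · simp_rw [hT]
      exact hh.1.mul (((hχm n).aestronglyMeasurable.mul hLT.1).add
        ((hcm n).aestronglyMeasurable.mul hL.1))
    · refine Eventually.of_forall fun y => ?_
      rw [hT, mul_add]
      refine (norm_add_le _ _).trans (add_le_add ?_ ?_)
      · rw [norm_mul, norm_mul, norm_mul]
        have := hχ1 n y.1
        gcongr
        exact mul_le_of_le_one_left (norm_nonneg _) this
      · rw [norm_mul, norm_mul, norm_mul, Complex.norm_real, Real.norm_eq_abs]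
        have h1 := (hcoef n y).trans (mul_le_of_le_one_left (by positivity) (ha1 n))
        calc _ = |a n * fderiv ℝ χ (a n • y.1) (worldVelocity y.2)| * (‖h y‖ * ‖Φ y‖) := by ring
          _ ≤ _ := by gcongr
    · refine Eventually.of_forall fun y => ?_
      simp_rw [hT]
      have h1 : Tendsto (fun n =>
          ((a n * fderiv ℝ χ (a n • y.1) (worldVelocity y.2) : ℝ) : ℂ)) atTop (𝓝 0) := by
        refine squeeze_zero_norm (fun n => ?_) (by simpa using hat.mul_const (B * 2))
        rw [Complex.norm_real]
        exact hcoef n y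
      have h2 := ((((hχt y.1).mul_const (transport Φ y)).add (h1.mul_const (Φ y))).const_mul (h y))
      simpa using h2
  have hlim2 : ∀ {f g : SpaceTime × E3 → ℂ}, MemLp f 2 (phaseMeasure R) →
      MemLp g 2 (phaseMeasure R) →
      Tendsto (fun n => ∫ y, f y * ((χ (a n • y.1) : ℂ) * g y) ∂(phaseMeasure R)) atTop
        (𝓝 (∫ y, f y * g y ∂(phaseMeasure R))) := fun {f g} hf hg => by
    refine tendsto_integral_of_dominated_convergence (fun y => ‖f y * g y‖) (fun n => ?_)
      (integrable_mul_of_memLp_two hf hg).norm (fun n => ?_) ?_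
    · exact hf.1.mul ((hχm n).aestronglyMeasurable.mul hg.1)
    · refine Eventually.of_forall fun y => ?_
      rw [norm_mul, norm_mul, norm_mul]
      have := hχ1 n y.1
      gcongr
      exact mul_le_of_le_one_left (norm_nonneg _) this
    · refine Eventually.of_forall fun y => ?_
      simpa using ((hχt y.1).mul_const (g y)).const_mul (f y)
  have hint : ∀ n i, Integrable (fun y => g₁ y i * ((χ (a n • y.1) : ℂ) * partialP i Φ y))
      (phaseMeasure R) := fun n i => by
    refine integrable_mul_of_memLp_two (memLp_coord hg₁ i) ((hLP i).of_le
      ((hχm n).aestronglyMeasurable.mul (hLP i).1) (Eventually.of_forall fun y => ?_))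
    rw [norm_mul]
    exact mul_le_of_le_one_left (norm_nonneg _) (hχ1 n y.1)
  have heq : ∀ n, -∫ y, h y * transport (cutoff χ (a n) Φ) y ∂(phaseMeasure R) =
      ∫ y, g₀ y * ((χ (a n • y.1) : ℂ) * Φ y) ∂(phaseMeasure R) -
        ∑ i, ∫ y, g₁ y i * ((χ (a n • y.1) : ℂ) * partialP i Φ y) ∂(phaseMeasure R) := fun n => by
    have h1 := hsol (cutoffTestFunction χ (a n) (ha0 n) hΦ hK hKR hΦK)
    simp_rw [partialT_add_sum_partialX] at h1
    rw [← integral_finsetSum _ fun i _ => hint n i]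
    simp_rw [← hP]
    exact h1
  refine tendsto_nhds_unique hlim1.neg ?_
  simp_rw [heq]
  exact (hlim2 hg₀ hL).sub (tendsto_finsetSum _ fun i _ => hlim2 (memLp_coord hg₁ i) (hLP i))

/-! ### Weighted `L²` bounds by duality -/

section Duality

variable {V : Type*} [NormedAddCommGroup V] [NormedSpace ℝ V] [FiniteDimensional ℝ V]
  [MeasurableSpace V] [BorelSpace V] {μ : Measure V} [IsFiniteMeasureOnCompacts μ]

/-- Both sides are continuous in `θ` for the `L²` norm, because `v ∈ L²` and `|w| ≤ 1`; smooth
compactly supported functions are dense. -/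
lemma enorm_integral_mul_le_of_forall_contDiff {v : V → ℂ} (hv : MemLp v 2 μ) {w : V → ℂ}
    (hw : Continuous w) (hw1 : ∀ ζ, ‖w ζ‖ ≤ 1) {M : ℝ≥0∞} (hM : M ≠ ∞)
    (H : ∀ θ : V → ℂ, HasCompactSupport θ → ContDiff ℝ (⊤ : ℕ∞) θ →
      ‖∫ ζ, v ζ * θ ζ ∂μ‖ₑ ≤ M * eLpNorm (fun ζ => w ζ * θ ζ) 2 μ)
    {θ : V → ℂ} (hθ : MemLp θ 2 μ) :
    ‖∫ ζ, v ζ * θ ζ ∂μ‖ₑ ≤ M * eLpNorm (fun ζ => w ζ * θ ζ) 2 μ := by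
  have key : ∀ δ : ℝ, 0 < δ → ‖∫ ζ, v ζ * θ ζ ∂μ‖ₑ ≤
      M * eLpNorm (fun ζ => w ζ * θ ζ) 2 μ + (M + eLpNorm v 2 μ) * ENNReal.ofReal δ := by
    intro δ hδ
    obtain ⟨η, hηc, hηs, hη⟩ := hθ.exist_eLpNorm_sub_le (by simp) one_le_two hδ
    have hηL : MemLp η 2 μ := hηs.continuous.memLp_of_hasCompactSupport hηc
    have h1 : ∫ ζ, v ζ * θ ζ ∂μ = ∫ ζ, v ζ * η ζ ∂μ + ∫ ζ, v ζ * (θ - η) ζ ∂μ := by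
      rw [← integral_add (integrable_mul_of_memLp_two hv hηL)
        (integrable_mul_of_memLp_two hv (hθ.sub hηL))]
      congr 1 with ζ
      simp
      ring
    have h2 : eLpNorm (fun ζ => w ζ * η ζ) 2 μ ≤
        eLpNorm (fun ζ => w ζ * θ ζ) 2 μ + ENNReal.ofReal δ := by
      have h3 : (fun ζ => w ζ * η ζ) = (fun ζ => w ζ * θ ζ) - fun ζ => w ζ * (θ - η) ζ := by
        ext ζ
        simp
        ring
      have h4 : eLpNorm (fun ζ => w ζ * (θ - η) ζ) 2 μ ≤ eLpNorm (θ - η) 2 μ :=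
        eLpNorm_mono fun ζ => by
          rw [norm_mul]; exact mul_le_of_le_one_left (norm_nonneg _) (hw1 ζ)
      rw [h3]
      refine (eLpNorm_sub_le (hw.aestronglyMeasurable.mul hθ.1)
        (hw.aestronglyMeasurable.mul (hθ.sub hηL).1) one_le_two).trans ?_
      exact add_le_add le_rfl (h4.trans hη)
    calc ‖∫ ζ, v ζ * θ ζ ∂μ‖ₑ ≤ ‖∫ ζ, v ζ * η ζ ∂μ‖ₑ + ‖∫ ζ, v ζ * (θ - η) ζ ∂μ‖ₑ := by
          rw [h1]; exact enorm_add_le _ _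
      _ ≤ M * (eLpNorm (fun ζ => w ζ * θ ζ) 2 μ + ENNReal.ofReal δ) +
          eLpNorm v 2 μ * ENNReal.ofReal δ := by
          refine add_le_add ((H η hηc hηs).trans (by gcongr)) ?_
          exact (enorm_integral_mul_le_eLpNorm_two hv.1 (hθ.sub hηL).1).trans (by gcongr)
      _ = _ := by ring
  have hlim : Tendsto (fun δ : ℝ => M * eLpNorm (fun ζ => w ζ * θ ζ) 2 μ +
      (M + eLpNorm v 2 μ) * ENNReal.ofReal δ) (𝓝[>] 0)
      (𝓝 (M * eLpNorm (fun ζ => w ζ * θ ζ) 2 μ + (M + eLpNorm v 2 μ) * ENNReal.ofReal 0)) := by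
    refine Tendsto.mono_left ?_ nhdsWithin_le_nhds
    refine Tendsto.const_add _ (ENNReal.Tendsto.const_mul ?_ (Or.inr ?_))
    · exact (ENNReal.continuous_ofReal.tendsto 0)
    · exact ENNReal.add_ne_top.2 ⟨hM, hv.eLpNorm_ne_top⟩
  rw [ENNReal.ofReal_zero, mul_zero, add_zero] at hlim
  exact ge_of_tendsto hlim (eventually_mem_nhdsWithin.mono fun δ hδ => key δ hδ)

/-- A weighted `L²` bound by duality with smooth compactly supported functions. -/
lemma eLpNorm_weight_mul_le_of_forall_contDiff {v : V → ℂ} (hv : MemLp v 2 μ) {w : V → ℝ}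
    (hw : Continuous w) (hw1 : ∀ ζ, 1 ≤ w ζ) {M : ℝ≥0∞} (hM : M ≠ ∞)
    (H : ∀ θ : V → ℂ, HasCompactSupport θ → ContDiff ℝ (⊤ : ℕ∞) θ →
      ‖∫ ζ, v ζ * θ ζ ∂μ‖ₑ ≤ M * eLpNorm (fun ζ => ((w ζ)⁻¹ : ℂ) * θ ζ) 2 μ) :
    eLpNorm (fun ζ => (w ζ : ℂ) * v ζ) 2 μ ≤ M := by
  have hw0 : ∀ ζ, 0 < w ζ := fun ζ => one_pos.trans_le (hw1 ζ)
  have hwc : Continuous fun ζ => (w ζ : ℂ) := Complex.continuous_ofReal.comp hw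
  have hwi : Continuous fun ζ => ((w ζ)⁻¹ : ℂ) := hwc.inv₀ fun ζ => by
    exact_mod_cast (hw0 ζ).ne'
  have hwi1 : ∀ ζ, ‖((w ζ)⁻¹ : ℂ)‖ ≤ 1 := fun ζ => by
    rw [norm_inv, Complex.norm_real, Real.norm_of_nonneg (hw0 ζ).le]
    exact inv_le_one_of_one_le₀ (hw1 ζ)
  have hball : ∀ n : ℕ, eLpNorm (fun ζ => (w ζ : ℂ) * v ζ) 2
      (μ.restrict (Metric.closedBall 0 n)) ≤ M := by
    intro n
    set S : Set V := Metric.closedBall 0 n with hS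
    have hSm : MeasurableSet S := Metric.isClosed_closedBall.measurableSet
    have : ProperSpace V := FiniteDimensional.proper_real V
    obtain ⟨B, hB⟩ := ((isCompact_closedBall (0 : V) n).image hwc).isBounded.exists_norm_le
    have hwv : MemLp (fun ζ => (w ζ : ℂ) * v ζ) 2 (μ.restrict S) := by
      refine (hv.restrict S).of_le_mul (c := B)
        (hwc.aestronglyMeasurable.mul (hv.restrict S).1) ?_
      filter_upwards [ae_restrict_mem hSm] with ζ hζ
      rw [norm_mul]
      gcongr
      exact hB _ ⟨ζ, hζ, rfl⟩
    have hwwv : MemLp (fun ζ => (w ζ : ℂ) * ((w ζ : ℂ) * (starRingEnd ℂ) (v ζ))) 2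
        (μ.restrict S) := by
      have hconj : AEStronglyMeasurable (fun ζ => (starRingEnd ℂ) (v ζ)) (μ.restrict S) :=
        Complex.continuous_conj.comp_aestronglyMeasurable (hv.restrict S).1
      refine hwv.of_le_mul (c := B)
        (hwc.aestronglyMeasurable.mul (hwc.aestronglyMeasurable.mul hconj)) ?_
      filter_upwards [ae_restrict_mem hSm] with ζ hζ
      rw [norm_mul, norm_mul, norm_mul, RCLike.norm_conj]
      gcongr
      exact hB _ ⟨ζ, hζ, rfl⟩
    -- This is the extremal choice `1_S w² v̄`: the pairing equals `‖w v‖²` on `S` and the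
    -- right-hand norm equals `‖w v‖` on `S`. The truncation to a ball makes `‖w v‖` finite, so that
    -- one factor can be cancelled.
    set θ : V → ℂ := S.indicator fun ζ => (w ζ : ℂ) * ((w ζ : ℂ) * (starRingEnd ℂ) (v ζ)) with hθd
    have hθ : MemLp θ 2 μ := (memLp_indicator_iff_restrict hSm).2 hwwv
    have h1 := enorm_integral_mul_le_of_forall_contDiff hv hwi hwi1 hM H hθ
    have h2 : eLpNorm (fun ζ => ((w ζ)⁻¹ : ℂ) * θ ζ) 2 μ =
        eLpNorm (fun ζ => (w ζ : ℂ) * v ζ) 2 (μ.restrict S) := by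
      rw [← eLpNorm_indicator_eq_eLpNorm_restrict hSm]
      refine eLpNorm_congr_norm_ae (Eventually.of_forall fun ζ => ?_)
      by_cases hζ : ζ ∈ S
      · have h0 : (w ζ : ℂ) ≠ 0 := by exact_mod_cast (hw0 ζ).ne'
        rw [hθd, indicator_of_mem hζ, indicator_of_mem hζ, inv_mul_cancel_left₀ h0, norm_mul,
          norm_mul, RCLike.norm_conj]
      · rw [hθd, indicator_of_notMem hζ, indicator_of_notMem hζ, mul_zero]
    have h3 : ‖∫ ζ, v ζ * θ ζ ∂μ‖ₑ =
        eLpNorm (fun ζ => (w ζ : ℂ) * v ζ) 2 (μ.restrict S) ^ 2 := by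
      have h4 : ∫ ζ, v ζ * θ ζ ∂μ = ((∫ ζ in S, ‖(w ζ : ℂ) * v ζ‖ ^ 2 ∂μ : ℝ) : ℂ) := by
        rw [← integral_complex_ofReal, ← integral_indicator hSm]
        congr 1 with ζ
        by_cases hζ : ζ ∈ S
        · rw [hθd, indicator_of_mem hζ, indicator_of_mem hζ, ← Complex.normSq_eq_norm_sq,
            ← Complex.mul_conj, map_mul, Complex.conj_ofReal]
          ring
        · rw [hθd, indicator_of_notMem hζ, indicator_of_notMem hζ, mul_zero]
      rw [h4, eLpNorm_two_sq, ← ofReal_norm, Complex.norm_real, Real.norm_of_nonneg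
        (integral_nonneg fun ζ => by positivity), ofReal_integral_eq_lintegral_ofReal
        ((memLp_two_iff_integrable_sq_norm hwv.1).1 hwv)
        (Eventually.of_forall fun ζ => by positivity)]
      refine lintegral_congr fun ζ => ?_
      rw [ENNReal.ofReal_pow (norm_nonneg _), ofReal_norm]
    rw [h2, h3, sq] at h1
    rcases eq_or_ne (eLpNorm (fun ζ => (w ζ : ℂ) * v ζ) 2 (μ.restrict S)) 0 with h0 | h0
    · rw [h0]; exact zero_le
    · exact (ENNReal.mul_le_mul_iff_left h0 hwv.eLpNorm_ne_top).1 h1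
  have hcover : AECover μ atTop fun n : ℕ => Metric.closedBall (0 : V) n :=
    aecover_closedBall tendsto_natCast_atTop_atTop
  have hlim := hcover.lintegral_tendsto_of_countably_generated
    (f := fun ζ => ‖(w ζ : ℂ) * v ζ‖ₑ ^ 2)
    ((hwc.aestronglyMeasurable.mul hv.1).enorm.pow_const 2)
  rw [← ENNReal.pow_le_pow_left_iff two_ne_zero, eLpNorm_two_sq]
  refine le_of_tendsto' hlim fun n => ?_
  rw [← eLpNorm_two_sq]
  exact pow_le_pow_left' (hball n) 2

end Duality

/-! ### The `L²` Fourier transform and Sobolev membership -/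

section Sobolev

variable {V : Type*} [NormedAddCommGroup V] [InnerProductSpace ℝ V] [FiniteDimensional ℝ V]
  [MeasurableSpace V] [BorelSpace V]

/-- The Fourier transform on `L²` is symmetric with respect to the bilinear pairing with smooth
compactly supported functions. -/
lemma integral_fourier_mul_eq (u : Lp ℂ 2 (volume : Measure V)) {θ : V → ℂ}
    (hθ : HasCompactSupport θ) (hθs : ContDiff ℝ (⊤ : ℕ∞) θ) :
    ∫ ζ, (𝓕 u : Lp ℂ 2 (volume : Measure V)) ζ * θ ζ = ∫ z, u z * 𝓕 θ z := by
  have h := Lp.fourier_toTemperedDistribution_eq u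
  have h2 := DFunLike.congr_fun h (hθ.toSchwartzMap hθs)
  rw [TemperedDistribution.fourier_apply, Lp.toTemperedDistribution_apply,
    Lp.toTemperedDistribution_apply, SchwartzMap.fourier_coe] at h2
  simp only [smul_eq_mul] at h2
  calc _ = ∫ ζ, (hθ.toSchwartzMap hθs) ζ * (𝓕 u : Lp ℂ 2 (volume : Measure V)) ζ := by
        exact integral_congr_ae (Eventually.of_forall fun ζ => mul_comm _ _)
    _ = _ := by
        rw [← h2]
        exact integral_congr_ae (Eventually.of_forall fun ζ => mul_comm _ _)

lemma memSobolev_of_memLp (s : ℝ) (u : Lp ℂ 2 (volume : Measure V))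
    (h : MemLp (fun ζ : V => (((1 + ‖ζ‖ ^ 2) ^ (s / 2) : ℝ) : ℂ) *
      (𝓕 u : Lp ℂ 2 (volume : Measure V)) ζ) 2 volume) :
    TemperedDistribution.MemSobolev s 2 (u : 𝓢'(V, ℂ)) := by
  rw [TemperedDistribution.memSobolev_iff_exists_smulLeftCLM_fourier]
  refine ⟨h.toLp _, ?_⟩
  rw [Lp.fourier_toTemperedDistribution_eq]
  ext g
  rw [TemperedDistribution.smulLeftCLM_apply_apply, Lp.toTemperedDistribution_apply,
    Lp.toTemperedDistribution_apply]
  refine integral_congr_ae ?_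
  filter_upwards [h.coeFn_toLp] with ζ hζ
  rw [hζ, SchwartzMap.smulLeftCLM_apply_apply (by fun_prop)]
  simp only [smul_eq_mul]
  ring

end Sobolev

/-! ### The regularized resolvent symbol and its bounds -/

section Symbols

/-- The denominator `√⟨ζ⟩ + i (τ + p̂ · ξ)` of the regularized resolvent of the transport
operator. -/
noncomputable def resolventDenom (y : SpaceTime × E3) : ℂ :=
  (√(bracket y.1) : ℂ) + (inner ℝ y.1 (worldVelocity y.2) : ℝ) * Complex.I

/-- The symbol `ψ(p) / (√⟨ζ⟩ + i (τ + p̂ · ξ))`. -/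
noncomputable def resolventSymbol (ψ : E3 → ℂ) (y : SpaceTime × E3) : ℂ :=
  ψ y.2 * (resolventDenom y)⁻¹

lemma bracket_pos (ζ : SpaceTime) : 0 < bracket ζ := one_pos.trans_le (one_le_bracket ζ)

lemma normSq_resolventDenom (ζ : SpaceTime) (p : E3) :
    ‖resolventDenom (ζ, p)‖ ^ 2 = bracket ζ + inner ℝ ζ (worldVelocity p) ^ 2 := by
  rw [← Complex.normSq_eq_norm_sq, resolventDenom, Complex.normSq_add_mul_I,
    Real.sq_sqrt (bracket_pos ζ).le]

lemma resolventDenom_ne_zero (y : SpaceTime × E3) : resolventDenom y ≠ 0 := by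
  have h := normSq_resolventDenom y.1 y.2
  have := bracket_pos y.1
  intro h0
  rw [Prod.mk.eta, h0] at h
  simp at h
  nlinarith [sq_nonneg (inner ℝ y.1 (worldVelocity y.2))]

lemma contDiff_sqrt_bracket : ContDiff ℝ (⊤ : ℕ∞) fun ζ : SpaceTime => √(bracket ζ) := by
  have h1 : ContDiff ℝ (⊤ : ℕ∞) bracket :=
    (contDiff_const.add (contDiff_norm_sq ℝ)).sqrt fun ζ => by positivity
  exact h1.sqrt fun ζ => (bracket_pos ζ).ne'

lemma contDiff_resolventDenom : ContDiff ℝ (⊤ : ℕ∞) resolventDenom := by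
  have h1 : ContDiff ℝ (⊤ : ℕ∞) fun y : SpaceTime × E3 => √(bracket y.1) :=
    contDiff_sqrt_bracket.comp contDiff_fst
  have h2 : ContDiff ℝ (⊤ : ℕ∞) fun y : SpaceTime × E3 => inner ℝ y.1 (worldVelocity y.2) :=
    contDiff_fst.inner ℝ (contDiff_worldVelocity.comp contDiff_snd)
  exact (Complex.ofRealCLM.contDiff.comp h1).add
    ((Complex.ofRealCLM.contDiff.comp h2).mul contDiff_const)

lemma contDiff_resolventSymbol {ψ : E3 → ℂ} (hψ : ContDiff ℝ (⊤ : ℕ∞) ψ) :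
    ContDiff ℝ (⊤ : ℕ∞) (resolventSymbol ψ) :=
  (hψ.comp contDiff_snd).mul (contDiff_resolventDenom.inv resolventDenom_ne_zero)

lemma fderiv_resolventSymbol {ψ : E3 → ℂ} (hψ : ContDiff ℝ (⊤ : ℕ∞) ψ) (ζ : SpaceTime)
    (p e : E3) :
    fderiv ℝ (resolventSymbol ψ) (ζ, p) (0, e) =
      fderiv ℝ ψ p e * (resolventDenom (ζ, p))⁻¹ -
        ψ p * ((inner ℝ ζ (fderiv ℝ worldVelocity p e) : ℝ) * Complex.I) *
          (resolventDenom (ζ, p) ^ 2)⁻¹ := by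
  have hline : HasDerivAt (fun s : ℝ => p + s • e) e 0 := by
    simpa using ((hasDerivAt_id (0 : ℝ)).smul_const e).const_add p
  have hline2 : HasDerivAt (fun s : ℝ => ((ζ, p + s • e) : SpaceTime × E3)) (0, e) 0 :=
    (hasDerivAt_const _ _).prodMk hline
  have h1 := HasFDerivAt.comp_hasDerivAt_of_eq (0 : ℝ)
    (((contDiff_resolventSymbol hψ).differentiable (by simp)) (ζ, p)).hasFDerivAt hline2 (by simp)
  refine h1.unique ?_
  have h2 := HasFDerivAt.comp_hasDerivAt_of_eq (0 : ℝ)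
    ((hψ.differentiable (by simp)) p).hasFDerivAt hline (by simp)
  have h3 := HasFDerivAt.comp_hasDerivAt_of_eq (0 : ℝ)
    ((contDiff_worldVelocity.differentiable (by simp)) p).hasFDerivAt hline (by simp)
  have h4 := (innerSL ℝ ζ).hasFDerivAt.comp_hasDerivAt (0 : ℝ) h3
  have h5 : HasDerivAt (fun s : ℝ => resolventDenom (ζ, p + s • e))
      ((inner ℝ ζ (fderiv ℝ worldVelocity p e) : ℝ) * Complex.I) 0 :=
    (h4.ofReal_comp.mul_const Complex.I).const_add (√(bracket ζ) : ℂ)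
  have h6 := h2.mul (h5.inv (resolventDenom_ne_zero _))
  refine h6.congr_deriv ?_
  simp
  ring

/-- Everything rests on `|D|² = ⟨ζ⟩ + b² ≥ ⟨ζ⟩`. In the worst term of the momentum derivative, `|ζ|²
/ |D|⁴ ≤ ⟨ζ⟩² / (⟨ζ⟩ (⟨ζ⟩ + b²))`, which is again the kernel. -/
lemma exists_symbol_bounds {ψ : E3 → ℂ} (hψ : ContDiff ℝ (⊤ : ℕ∞) ψ) (hc : HasCompactSupport ψ)
    (R : ℝ) :
    ∃ A : ℝ, 0 ≤ A ∧ ∀ ζ : SpaceTime, ∀ p ∈ Metric.ball (0 : E3) R,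
      ‖resolventSymbol ψ (ζ, p)‖ ^ 2 ≤
        A * (bracket ζ / (bracket ζ + inner ℝ ζ (worldVelocity p) ^ 2)) ∧
      ‖(√(bracket ζ) : ℂ) * resolventSymbol ψ (ζ, p)‖ ^ 2 ≤
        A * (bracket ζ / (bracket ζ + inner ℝ ζ (worldVelocity p) ^ 2)) ∧
      ∀ e : E3, ‖e‖ = 1 → ‖fderiv ℝ (resolventSymbol ψ) (ζ, p) (0, e)‖ ^ 2 ≤
        A * (bracket ζ / (bracket ζ + inner ℝ ζ (worldVelocity p) ^ 2)) := by
  obtain ⟨B₀, hB₀⟩ := hψ.continuous.bounded_above_of_compact_support hc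
  obtain ⟨B₁, hB₁⟩ := (hψ.continuous_fderiv (by simp)).bounded_above_of_compact_support
    (hc.fderiv ℝ)
  obtain ⟨B₂, hB₂⟩ := ((isCompact_closedBall (0 : E3) R).image
    (contDiff_worldVelocity.continuous_fderiv (by simp))).isBounded.exists_norm_le
  -- `B₀`, `B₁`, `B₂` bound `ψ`, its derivative and the derivative of `(1, p̂)`; the `2` comes from
  -- `|X - Y|² ≤ 2 (|X|² + |Y|²)`.
  refine ⟨2 * (B₀ ^ 2 + B₁ ^ 2 + B₀ ^ 2 * B₂ ^ 2), by positivity, fun ζ p hp => ?_⟩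
  have hJ1 := one_le_bracket ζ
  have hJsq := bracket_sq ζ
  have hD := normSq_resolventDenom ζ p
  set J := bracket ζ
  set D := resolventDenom (ζ, p)
  set b := inner ℝ ζ (worldVelocity p)
  have hJ0 : 0 < J := by linarith
  have hN : 0 < J + b ^ 2 := by positivity
  have hψ2 : ‖ψ p‖ ^ 2 ≤ B₀ ^ 2 := by have := hB₀ p; gcongr
  have hq : 0 ≤ J / (J + b ^ 2) := by positivity
  have hinv : ‖D⁻¹‖ ^ 2 = (J + b ^ 2)⁻¹ := by rw [norm_inv, inv_pow, hD]
  have hle : (J + b ^ 2)⁻¹ ≤ J / (J + b ^ 2) := by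
    rw [div_eq_mul_inv]; exact le_mul_of_one_le_left (by positivity) hJ1
  have hBB : 0 ≤ B₀ ^ 2 * B₂ ^ 2 := by positivity
  refine ⟨?_, ?_, fun e he => ?_⟩
  · rw [resolventSymbol, norm_mul, mul_pow, hinv]
    exact mul_le_mul (by nlinarith [sq_nonneg B₁, sq_nonneg B₀]) hle (by positivity) (by positivity)
  · rw [resolventSymbol, norm_mul, norm_mul, mul_pow, mul_pow, hinv, Complex.norm_real,
      Real.norm_of_nonneg (Real.sqrt_nonneg _), Real.sq_sqrt hJ0.le]
    calc J * (‖ψ p‖ ^ 2 * (J + b ^ 2)⁻¹) = ‖ψ p‖ ^ 2 * (J / (J + b ^ 2)) := by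
          rw [div_eq_mul_inv]; ring
      _ ≤ _ := by
          gcongr
          nlinarith [sq_nonneg B₁, sq_nonneg B₀]
  · rw [fderiv_resolventSymbol hψ]
    set X := fderiv ℝ ψ p e * D⁻¹
    set Y := ψ p * ((inner ℝ ζ (fderiv ℝ worldVelocity p e) : ℝ) * Complex.I) * (D ^ 2)⁻¹ with hY
    have hX : ‖X‖ ^ 2 ≤ B₁ ^ 2 * (J / (J + b ^ 2)) := by
      rw [norm_mul, mul_pow, hinv]
      have h1 : ‖fderiv ℝ ψ p e‖ ≤ B₁ := by
        have := ((fderiv ℝ ψ p).le_opNorm e).trans_eq (by rw [he, mul_one])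
        exact this.trans (hB₁ p)
      gcongr
    have hY' : ‖Y‖ ^ 2 ≤ B₀ ^ 2 * B₂ ^ 2 * (J / (J + b ^ 2)) := by
      have h1 : |inner ℝ ζ (fderiv ℝ worldVelocity p e)| ≤ ‖ζ‖ * B₂ := by
        refine (abs_real_inner_le_norm _ _).trans ?_
        have h2 : ‖fderiv ℝ worldVelocity p‖ ≤ B₂ :=
          hB₂ _ ⟨p, Metric.ball_subset_closedBall hp, rfl⟩
        have := ((fderiv ℝ worldVelocity p).le_opNorm e).trans_eq (by rw [he, mul_one])
        gcongr
        exact this.trans h2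
      have h3 : inner ℝ ζ (fderiv ℝ worldVelocity p e) ^ 2 ≤ J ^ 2 * B₂ ^ 2 := by
        rw [← sq_abs]
        calc _ ≤ (‖ζ‖ * B₂) ^ 2 := by gcongr
          _ = ‖ζ‖ ^ 2 * B₂ ^ 2 := by ring
          _ ≤ _ := mul_le_mul_of_nonneg_right (by linarith) (sq_nonneg _)
      have h4 : ‖Y‖ ^ 2 = ‖ψ p‖ ^ 2 * inner ℝ ζ (fderiv ℝ worldVelocity p e) ^ 2 *
          ((J + b ^ 2)⁻¹ * (J + b ^ 2)⁻¹) := by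
        rw [hY, norm_mul, norm_mul, norm_mul, Complex.norm_I, mul_one, Complex.norm_real,
          Real.norm_eq_abs, mul_pow, mul_pow, sq_abs, ← hinv, norm_inv,
          norm_inv, norm_pow]
        ring
      have h5 : (J + b ^ 2)⁻¹ ≤ J⁻¹ := inv_anti₀ hJ0 (by nlinarith [sq_nonneg b])
      rw [h4]
      calc _ ≤ B₀ ^ 2 * (J ^ 2 * B₂ ^ 2) * (J⁻¹ * (J + b ^ 2)⁻¹) := by gcongr
        _ = _ := by field_simp
    have h6 : ‖X - Y‖ ^ 2 ≤ 2 * (‖X‖ ^ 2 + ‖Y‖ ^ 2) := by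
      have h7 := norm_sub_le X Y
      have h8 : ‖X - Y‖ ^ 2 ≤ (‖X‖ + ‖Y‖) ^ 2 := by gcongr
      nlinarith [sq_nonneg (‖X‖ - ‖Y‖)]
    have h9 : 0 ≤ B₀ ^ 2 * (J / (J + b ^ 2)) := by positivity
    calc _ ≤ 2 * (‖X‖ ^ 2 + ‖Y‖ ^ 2) := h6
      _ ≤ _ := by linarith

/-- The weight of the Sobolev space of order `1 / 4`. -/
noncomputable def sobolevWeight (ζ : SpaceTime) : ℝ := (1 + ‖ζ‖ ^ 2) ^ ((1 / 4 : ℝ) / 2)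

lemma one_le_sobolevWeight (ζ : SpaceTime) : 1 ≤ sobolevWeight ζ :=
  Real.one_le_rpow (by nlinarith [norm_nonneg ζ]) (by norm_num)

lemma sobolevWeight_sq (ζ : SpaceTime) : sobolevWeight ζ ^ 2 = √(bracket ζ) := by
  have h0 : 0 ≤ 1 + ‖ζ‖ ^ 2 := by positivity
  rw [sobolevWeight, bracket, Real.sqrt_eq_rpow, Real.sqrt_eq_rpow, ← Real.rpow_mul h0,
    ← Real.rpow_natCast, ← Real.rpow_mul h0]
  norm_num

lemma continuous_sobolevWeight : Continuous sobolevWeight :=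
  Continuous.rpow_const (by fun_prop) fun ζ => Or.inr (by norm_num)

/-- Plancherel reduces the norm to the momentum integral of `|m|²`, which the kernel estimate bounds
by `A C / √⟨ζ⟩`, that is, `A C` times the inverse square of `sobolevWeight`. -/
lemma exists_eLpNorm_partialFourier_le {R : ℝ} (hR : 0 < R) :
    ∃ C : ℝ, 0 ≤ C ∧ ∀ (A : ℝ) (θ : SpaceTime → ℂ) (m : SpaceTime × E3 → ℂ), 0 ≤ A →
      HasCompactSupport θ → ContDiff ℝ (⊤ : ℕ∞) (fun y : SpaceTime × E3 => θ y.1 * m y) →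
      (∀ ζ : SpaceTime, ∀ p ∈ Metric.ball (0 : E3) R, ‖m (ζ, p)‖ ^ 2 ≤
        A * (bracket ζ / (bracket ζ + inner ℝ ζ (worldVelocity p) ^ 2))) →
      eLpNorm (partialFourier fun y => θ y.1 * m y) 2 (phaseMeasure R) ≤
        ENNReal.ofReal √(A * C) *
          eLpNorm (fun ζ => ((sobolevWeight ζ)⁻¹ : ℂ) * θ ζ) 2 volume := by
  obtain ⟨C, hC0, hC⟩ := exists_setLIntegral_kernel_le hR
  refine ⟨C, hC0, fun A θ m hA hθ hs hm => ?_⟩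
  have h1 : ∀ ζ, ∫⁻ p in Metric.ball 0 R, ‖m (ζ, p)‖ₑ ^ 2 ≤
      ENNReal.ofReal (A * C / √(bracket ζ)) := fun ζ => by
    calc ∫⁻ p in Metric.ball 0 R, ‖m (ζ, p)‖ₑ ^ 2
        ≤ ∫⁻ p in Metric.ball 0 R, ENNReal.ofReal A *
          ENNReal.ofReal (bracket ζ / (bracket ζ + inner ℝ ζ (worldVelocity p) ^ 2)) := by
          refine setLIntegral_mono' measurableSet_ball fun p hp => ?_
          rw [← ENNReal.ofReal_mul hA, ← ofReal_norm, ← ENNReal.ofReal_pow (norm_nonneg _)]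
          exact ENNReal.ofReal_le_ofReal (hm ζ p hp)
      _ = ENNReal.ofReal A * _ := lintegral_const_mul' _ _ ENNReal.ofReal_ne_top
      _ ≤ ENNReal.ofReal A * ENNReal.ofReal (C / √(bracket ζ)) := by gcongr; exact hC ζ
      _ = _ := by rw [← ENNReal.ofReal_mul hA, mul_div_assoc]
  have h2 := eLpNorm_partialFourier_le hs (K := tsupport θ) hθ
    (fun ζ hζ => image_eq_zero_of_notMem_tsupport hζ) h1
  rw [← ENNReal.pow_le_pow_left_iff two_ne_zero]
  refine h2.trans_eq ?_
  rw [mul_pow, eLpNorm_two_sq, ← ENNReal.ofReal_pow (Real.sqrt_nonneg _),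
    Real.sq_sqrt (by positivity), ← lintegral_const_mul' _ _ ENNReal.ofReal_ne_top]
  refine lintegral_congr fun ζ => ?_
  have hw : 0 < sobolevWeight ζ := one_pos.trans_le (one_le_sobolevWeight ζ)
  have h3 : ‖((sobolevWeight ζ)⁻¹ : ℂ)‖ₑ ^ 2 = ENNReal.ofReal (√(bracket ζ))⁻¹ := by
    rw [← ofReal_norm, ← ENNReal.ofReal_pow (norm_nonneg _), norm_inv, Complex.norm_real,
      Real.norm_of_nonneg hw.le, inv_pow, sobolevWeight_sq]
  rw [enorm_mul, mul_pow, h3, ← mul_assoc, ← ENNReal.ofReal_mul (by positivity), mul_comm,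
    div_eq_mul_inv]

end Symbols

/-! ### Square integrability and pairing of the momentum average -/

section Average

variable {R : ℝ} {ψ : E3 → ℂ} {h : SpaceTime × E3 → ℂ}

lemma ae_memLp_slice (hh : MemLp h 2 (phaseMeasure R)) :
    ∀ᵐ z : SpaceTime, MemLp (fun p => h (z, p)) 2 (volume.restrict (Metric.ball 0 R)) := by
  rw [phaseMeasure_eq_prod] at hh
  have h1 := ((memLp_two_iff_integrable_sq_norm hh.1).1 hh).prod_right_ae
  filter_upwards [h1, hh.1.prodMk_left] with z hz hm
  exact (memLp_two_iff_integrable_sq_norm hm).2 hz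

lemma ae_integrableOn_mul_slice (hψ : MemLp ψ 2 (volume.restrict (Metric.ball 0 R)))
    (hh : MemLp h 2 (phaseMeasure R)) :
    ∀ᵐ z : SpaceTime, IntegrableOn (fun p => ψ p * h (z, p)) (Metric.ball 0 R) := by
  filter_upwards [ae_memLp_slice hh] with z hz
  exact integrable_mul_of_memLp_two hψ hz

/-- Cauchy–Schwarz in `p` on almost every slice, followed by Tonelli. -/
lemma memLp_average (hψc : Continuous ψ) (hψ : MemLp ψ 2 (volume.restrict (Metric.ball 0 R)))
    (hh : MemLp h 2 (phaseMeasure R)) : MemLp (average R ψ h) 2 volume := by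
  have hhp := hh
  rw [phaseMeasure_eq_prod] at hhp
  have hm : AEStronglyMeasurable (average R ψ h) volume :=
    ((hψc.comp continuous_snd).aestronglyMeasurable.mul hhp.1).integral_prod_right'
  refine ⟨hm, ?_⟩
  refine lt_of_pow_lt_pow_left' 2 ?_
  rw [ENNReal.top_pow two_ne_zero, eLpNorm_two_sq]
  calc ∫⁻ z, ‖average R ψ h z‖ₑ ^ 2
      ≤ ∫⁻ z, eLpNorm ψ 2 (volume.restrict (Metric.ball 0 R)) ^ 2 *
          ∫⁻ p in Metric.ball 0 R, ‖h (z, p)‖ₑ ^ 2 := by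
        refine lintegral_mono_ae ?_
        filter_upwards [ae_memLp_slice hh] with z hz
        rw [← eLpNorm_two_sq, ← mul_pow]
        exact pow_le_pow_left' (enorm_integral_mul_le_eLpNorm_two hψ.1 hz.1) 2
    _ = eLpNorm ψ 2 (volume.restrict (Metric.ball 0 R)) ^ 2 * eLpNorm h 2 (phaseMeasure R) ^ 2 := by
        rw [lintegral_const_mul' _ _ (ENNReal.pow_ne_top hψ.eLpNorm_ne_top),
          eLpNorm_two_sq h, phaseMeasure_eq_prod, lintegral_prod _ (hhp.1.enorm.pow_const 2)]
    _ < ∞ := ENNReal.mul_lt_top (ENNReal.pow_lt_top hψ.eLpNorm_lt_top)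
        (ENNReal.pow_lt_top hh.eLpNorm_lt_top)

lemma integral_average_mul {f : SpaceTime → ℂ} (hh : MemLp h 2 (phaseMeasure R))
    (hf : MemLp (fun y : SpaceTime × E3 => ψ y.2 * f y.1) 2 (phaseMeasure R)) :
    ∫ z, average R ψ h z * f z = ∫ y, h y * (ψ y.2 * f y.1) ∂(phaseMeasure R) := by
  have hint := integrable_mul_of_memLp_two hh hf
  rw [phaseMeasure_eq_prod] at hint ⊢
  rw [integral_prod _ hint]
  refine integral_congr_ae (Eventually.of_forall fun z => ?_)
  simp only [average]
  rw [← integral_mul_const]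
  refine integral_congr_ae (Eventually.of_forall fun p => ?_)
  simp only
  ring

end Average

/-! ### The test function built from the resolvent symbol -/

section TestFunction

variable {R : ℝ} {ψ : E3 → ℂ} {θ : SpaceTime → ℂ}

lemma contDiff_mul_fst (hθs : ContDiff ℝ (⊤ : ℕ∞) θ) {m : SpaceTime × E3 → ℂ}
    (hm : ContDiff ℝ (⊤ : ℕ∞) m) : ContDiff ℝ (⊤ : ℕ∞) fun y : SpaceTime × E3 => θ y.1 * m y :=
  (hθs.comp contDiff_fst).mul hm

lemma mul_fst_eq_zero (m : SpaceTime × E3 → ℂ) (ζ : SpaceTime) (p : E3) (hζ : ζ ∉ tsupport θ) :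
    θ ζ * m (ζ, p) = 0 := by
  rw [image_eq_zero_of_notMem_tsupport hζ, zero_mul]

lemma partialFourier_mul_snd (y : SpaceTime × E3) :
    partialFourier (fun y => θ y.1 * ψ y.2) y = ψ y.2 * 𝓕 θ y.1 := by
  rw [partialFourier, Real.fourier_eq', Real.fourier_eq', ← integral_const_mul]
  refine integral_congr_ae (Eventually.of_forall fun ζ => ?_)
  simp only [smul_eq_mul]
  ring

lemma fderiv_mul_fst_right (hθs : ContDiff ℝ (⊤ : ℕ∞) θ) {m : SpaceTime × E3 → ℂ}
    (hm : ContDiff ℝ (⊤ : ℕ∞) m) (y : SpaceTime × E3) (e : E3) :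
    fderiv ℝ (fun y : SpaceTime × E3 => θ y.1 * m y) y (0, e) =
      θ y.1 * fderiv ℝ m y (0, e) := by
  have h1 := ((hθs.differentiable (by simp)) y.1).hasFDerivAt.comp y hasFDerivAt_fst
  have h2 := h1.mul ((hm.differentiable (by simp)) y).hasFDerivAt
  have h3 : HasFDerivAt (fun y : SpaceTime × E3 => θ y.1 * m y) _ y := h2
  rw [h3.fderiv]
  simp

lemma partialP_partialFourier (hθ : HasCompactSupport θ) (hθs : ContDiff ℝ (⊤ : ℕ∞) θ)
    {m : SpaceTime × E3 → ℂ} (hm : ContDiff ℝ (⊤ : ℕ∞) m) (i : Fin 3) :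
    partialP i (partialFourier fun y => θ y.1 * m y) =
      partialFourier fun y => θ y.1 * fderiv ℝ m y (0, EuclideanSpace.single i 1) := by
  ext y
  rw [partialP, fderiv_partialFourier_right (contDiff_mul_fst hθs hm) hθ (mul_fst_eq_zero m)]
  simp_rw [fderiv_mul_fst_right hθs hm]

/-- The transport operator applied to the regularized solution of the transport equation. -/
lemma transport_partialFourier (hθ : HasCompactSupport θ) (hθs : ContDiff ℝ (⊤ : ℕ∞) θ)
    (hψ : ContDiff ℝ (⊤ : ℕ∞) ψ) (y : SpaceTime × E3) :
    transport (partialFourier fun y => θ y.1 * resolventSymbol ψ y) y =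
      (2 * Real.pi : ℂ) * (partialFourier
        (fun y => θ y.1 * ((√(bracket y.1) : ℂ) * resolventSymbol ψ y)) y -
          ψ y.2 * 𝓕 θ y.1) := by
  rw [transport, fderiv_partialFourier_left
    (contDiff_mul_fst hθs (contDiff_resolventSymbol hψ)) hθ (mul_fst_eq_zero _),
    ← partialFourier_mul_snd, partialFourier_eq_integral, partialFourier_eq_integral,
    ← integral_sub, ← integral_const_mul, Real.fourier_eq']
  · refine integral_congr_ae (Eventually.of_forall fun ζ => ?_)
    have hD : resolventDenom (ζ, y.2) = (√(bracket ζ) : ℂ) +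
      (inner ℝ ζ (worldVelocity y.2) : ℝ) * Complex.I := rfl
    have hD0 := resolventDenom_ne_zero (ζ, y.2)
    simp only [phaseIntegrand, resolventSymbol, smul_eq_mul]
    -- The identity `i b / D = 1 - √⟨ζ⟩ / D` inverts the transport operator up to the regularizing
    -- term.
    have hb : ((inner ℝ ζ (worldVelocity y.2) : ℝ) : ℂ) * Complex.I * (resolventDenom (ζ, y.2))⁻¹ =
        1 - (√(bracket ζ) : ℂ) * (resolventDenom (ζ, y.2))⁻¹ := by
      field_simp
      rw [hD]
      ring
    have hpush : ((-2 * Real.pi * inner ℝ ζ (worldVelocity y.2) : ℝ) : ℂ) =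
        -2 * (Real.pi : ℂ) * ((inner ℝ ζ (worldVelocity y.2) : ℝ) : ℂ) := by push_cast; ring
    rw [hpush]
    linear_combination (-2 * (Real.pi : ℂ) *
      Complex.exp (((-2 * Real.pi * inner ℝ ζ y.1 : ℝ) : ℂ) * Complex.I) * θ ζ * ψ y.2) * hb
  · refine Continuous.integrable_of_hasCompactSupport (Continuous.comp
      (contDiff_phaseIntegrand (contDiff_mul_fst hθs (ContDiff.mul ?_
        (contDiff_resolventSymbol hψ)))).continuous (Continuous.prodMk_right y))
      (HasCompactSupport.intro hθ fun ζ hζ => phaseIntegrand_eq_zero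
        (mul_fst_eq_zero fun y => (√(bracket y.1) : ℂ) * resolventSymbol ψ y) y ζ hζ)
    exact Complex.ofRealCLM.contDiff.comp (contDiff_sqrt_bracket.comp contDiff_fst)
  · exact Continuous.integrable_of_hasCompactSupport (Continuous.comp
      (contDiff_phaseIntegrand (contDiff_mul_fst hθs (hψ.comp contDiff_snd))).continuous
        (Continuous.prodMk_right y))
      (HasCompactSupport.intro hθ fun ζ hζ =>
        phaseIntegrand_eq_zero (mul_fst_eq_zero fun y => ψ y.2) y ζ hζ)

/-- This function is the partial Fourier transform of the separated symbol `θ(ζ) ψ(p)`, so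
Plancherel bounds it by `‖θ‖ ‖ψ‖`. -/
lemma memLp_mul_fourier (hθ : HasCompactSupport θ) (hθs : ContDiff ℝ (⊤ : ℕ∞) θ)
    (hψ : ContDiff ℝ (⊤ : ℕ∞) ψ) (hψc : HasCompactSupport ψ) :
    MemLp (fun y : SpaceTime × E3 => ψ y.2 * 𝓕 θ y.1) 2 (phaseMeasure R) := by
  have hs : ContDiff ℝ (⊤ : ℕ∞) fun y : SpaceTime × E3 => θ y.1 * ψ y.2 :=
    contDiff_mul_fst hθs (hψ.comp contDiff_snd)
  have hψL : MemLp ψ 2 (volume.restrict (Metric.ball (0 : E3) R)) :=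
    hψ.continuous.memLp_of_hasCompactSupport hψc
  have hθL : MemLp θ 2 (volume : Measure SpaceTime) :=
    hθs.continuous.memLp_of_hasCompactSupport hθ
  rw [← funext partialFourier_mul_snd]
  refine ⟨(contDiff_partialFourier hs hθ
    (mul_fst_eq_zero fun y => ψ y.2)).continuous.aestronglyMeasurable, ?_⟩
  refine lt_of_pow_lt_pow_left' 2 ?_
  rw [ENNReal.top_pow two_ne_zero]
  refine (eLpNorm_partialFourier_le (K := tsupport θ) (m := fun y => ψ y.2) hs hθ
    (fun ζ hζ => image_eq_zero_of_notMem_tsupport hζ) (fun ζ => (eLpNorm_two_sq ψ _).ge)).trans_lt ?_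
  rw [lintegral_mul_const' _ _ (ENNReal.pow_ne_top hψL.eLpNorm_ne_top), ← eLpNorm_two_sq]
  exact ENNReal.mul_lt_top (ENNReal.pow_lt_top hθL.eLpNorm_lt_top)
    (ENNReal.pow_lt_top hψL.eLpNorm_lt_top)

end TestFunction

/-! ### The averaging estimate and the theorem -/

/-- The averaging estimate tested against a smooth compactly supported function of the frequency. -/
lemma exists_enorm_integral_average_mul_fourier_le {R : ℝ} (hR : 0 < R)
    (ψ : 𝓓(momentumBall R, ℂ)) :
    ∃ C : ℝ, 0 < C ∧ ∀ (h g₀ : SpaceTime × E3 → ℂ)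
      (g₁ : SpaceTime × E3 → EuclideanSpace ℂ (Fin 3)),
      MemLp h 2 (phaseMeasure R) → MemLp g₀ 2 (phaseMeasure R) → MemLp g₁ 2 (phaseMeasure R) →
      IsDistribSolution R h g₀ g₁ →
      ∀ θ : SpaceTime → ℂ, HasCompactSupport θ → ContDiff ℝ (⊤ : ℕ∞) θ →
        ‖∫ z, average R ψ h z * 𝓕 θ z‖ₑ ≤
          ENNReal.ofReal C * (eLpNorm h 2 (phaseMeasure R) + eLpNorm g₀ 2 (phaseMeasure R) +
            eLpNorm g₁ 2 (phaseMeasure R)) *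
            eLpNorm (fun ζ => ((sobolevWeight ζ)⁻¹ : ℂ) * θ ζ) 2 volume := by
  have hψs : ContDiff ℝ (⊤ : ℕ∞) ψ := ψ.contDiff
  have hψc : HasCompactSupport ψ := ψ.hasCompactSupport
  obtain ⟨A, hA0, hA⟩ := exists_symbol_bounds hψs hψc R
  obtain ⟨C, hC0, hC⟩ := exists_eLpNorm_partialFourier_le hR
  -- The `3` counts the components of `g₁`; the `+ 1` only makes the constant positive when `A * C =
  -- 0`.
  refine ⟨3 * √(A * C) + 1, by positivity, fun h g₀ g₁ hh hg₀ hg₁ hsol θ hθ hθs => ?_⟩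
  set N := eLpNorm (fun ζ => ((sobolevWeight ζ)⁻¹ : ℂ) * θ ζ) 2 volume with hN
  have hwc : Continuous fun ζ => ((sobolevWeight ζ)⁻¹ : ℂ) :=
    (Complex.continuous_ofReal.comp continuous_sobolevWeight).inv₀ fun ζ => by
      simpa using (one_pos.trans_le (one_le_sobolevWeight ζ)).ne'
  have hNtop : N ≠ ∞ := ((hwc.mul hθs.continuous).memLp_of_hasCompactSupport
    (hθ.mul_left (f := fun ζ => ((sobolevWeight ζ)⁻¹ : ℂ)))).eLpNorm_ne_top
  set L := ENNReal.ofReal √(A * C) with hL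
  have hbound : ∀ m : SpaceTime × E3 → ℂ, ContDiff ℝ (⊤ : ℕ∞) m →
      (∀ ζ : SpaceTime, ∀ p ∈ Metric.ball (0 : E3) R, ‖m (ζ, p)‖ ^ 2 ≤
        A * (bracket ζ / (bracket ζ + inner ℝ ζ (worldVelocity p) ^ 2))) →
      MemLp (partialFourier fun y => θ y.1 * m y) 2 (phaseMeasure R) ∧
        eLpNorm (partialFourier fun y => θ y.1 * m y) 2 (phaseMeasure R) ≤ L * N :=
    fun m hm hmb => by
      have h1 := hC A θ m hA0 hθ (contDiff_mul_fst hθs hm) hmb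
      refine ⟨⟨(contDiff_partialFourier (contDiff_mul_fst hθs hm) hθ
        (mul_fst_eq_zero m)).continuous.aestronglyMeasurable, h1.trans_lt ?_⟩, h1⟩
      exact ENNReal.mul_lt_top ENNReal.ofReal_lt_top hNtop.lt_top
  have hm₀ := contDiff_resolventSymbol hψs
  have hmh : ContDiff ℝ (⊤ : ℕ∞) fun y : SpaceTime × E3 =>
      (√(bracket y.1) : ℂ) * resolventSymbol ψ y :=
    ContDiff.mul (Complex.ofRealCLM.contDiff.comp (contDiff_sqrt_bracket.comp contDiff_fst)) hm₀
  obtain ⟨hL₀, hB₀⟩ := hbound _ hm₀ fun ζ p hp => (hA ζ p hp).1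
  obtain ⟨hLh, hBh⟩ := hbound _ hmh fun ζ p hp => (hA ζ p hp).2.1
  have hP := fun i => hbound _ (contDiff_fderiv_right hm₀ (EuclideanSpace.single i (1 : ℝ)))
    fun ζ p hp => (hA ζ p hp).2.2 _ (by simp)
  simp_rw [← partialP_partialFourier hθ hθs hm₀] at hP
  have hψθ : MemLp (fun y : SpaceTime × E3 => ψ y.2 * 𝓕 θ y.1) 2 (phaseMeasure R) :=
    memLp_mul_fourier hθ hθs hψs hψc
  have hT := funext (transport_partialFourier hθ hθs hψs)
  have hLT : MemLp (transport (partialFourier fun y => θ y.1 * resolventSymbol ψ y)) 2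
      (phaseMeasure R) := by
    rw [hT]
    exact (hLh.sub hψθ).const_mul _
  -- The test function `F(θ ψ/D)` inherits compact momentum support from `ψ` but need not have
  -- compact support in space-time, hence the extended weak formulation.
  have heq := hsol.integral_transport_eq hh hg₀ hg₁
    (contDiff_partialFourier (contDiff_mul_fst hθs hm₀) hθ (mul_fst_eq_zero _))
    hψc.isCompact ψ.tsupport_subset (fun z p hp => by
      simp [partialFourier, resolventSymbol, image_eq_zero_of_notMem_tsupport hp,
        Real.fourier_eq']) hL₀ hLT fun i => (hP i).1
  have hTint : ∫ y, h y * transport (partialFourier fun y => θ y.1 * resolventSymbol ψ y) y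
      ∂(phaseMeasure R) = (2 * Real.pi : ℂ) * (∫ y, h y * partialFourier (fun y => θ y.1 *
        ((√(bracket y.1) : ℂ) * resolventSymbol ψ y)) y ∂(phaseMeasure R) -
        ∫ z, average R ψ h z * 𝓕 θ z) := by
    rw [integral_average_mul hh hψθ, ← integral_sub (integrable_mul_of_memLp_two hh hLh)
      (integrable_mul_of_memLp_two hh hψθ), ← integral_const_mul]
    refine integral_congr_ae (Eventually.of_forall fun y => ?_)
    simp only
    rw [congrFun hT y]
    ring
  rw [hTint] at heq
  have hpi : (2 * Real.pi : ℂ) ≠ 0 := by simp [Real.pi_ne_zero]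
  have hpi1 : ‖(2 * Real.pi : ℂ)⁻¹‖ₑ ≤ 1 := by
    rw [← ofReal_norm, ENNReal.ofReal_le_one, norm_inv]
    refine inv_le_one_of_one_le₀ ?_
    simp only [norm_mul, Complex.norm_ofNat, Complex.norm_real, Real.norm_eq_abs]
    rw [abs_of_pos Real.pi_pos]
    linarith [Real.pi_gt_three]
  set X := ∫ z, average R ψ h z * 𝓕 θ z
  set Yh := ∫ y, h y * partialFourier (fun y => θ y.1 *
        ((√(bracket y.1) : ℂ) * resolventSymbol ψ y)) y ∂(phaseMeasure R)
  set Y₀ := ∫ y, g₀ y * partialFourier (fun y => θ y.1 * resolventSymbol ψ y) y ∂(phaseMeasure R)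
  set Y₁ := fun i => ∫ y, g₁ y i * partialP i
    (partialFourier (fun y => θ y.1 * resolventSymbol ψ y)) y ∂(phaseMeasure R) with hY₁
  -- Solving the weak formulation for the pairing with the average; the factor `(2π)⁻¹` is later
  -- bounded by `1`.
  have hX : X = Yh + (2 * Real.pi : ℂ)⁻¹ * (Y₀ - ∑ i, Y₁ i) := by
    rw [← heq]
    field_simp
    ring
  have e1 : ‖Yh‖ₑ ≤ eLpNorm h 2 (phaseMeasure R) * (L * N) :=
    (enorm_integral_mul_le_eLpNorm_two hh.1 hLh.1).trans (by gcongr)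
  have e2 : ‖Y₀‖ₑ ≤ eLpNorm g₀ 2 (phaseMeasure R) * (L * N) :=
    (enorm_integral_mul_le_eLpNorm_two hg₀.1 hL₀.1).trans (by gcongr)
  have e3 : ∀ i, ‖Y₁ i‖ₑ ≤ eLpNorm g₁ 2 (phaseMeasure R) * (L * N) := fun i => by
    refine (enorm_integral_mul_le_eLpNorm_two (memLp_coord hg₁ i).1 (hP i).1.1).trans ?_
    refine mul_le_mul' (eLpNorm_mono fun y => ?_) (hP i).2
    exact PiLp.norm_apply_le (g₁ y) i
  have e4 : ‖∑ i, Y₁ i‖ₑ ≤ 3 * (eLpNorm g₁ 2 (phaseMeasure R) * (L * N)) := by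
    refine (enorm_sum_le _ _).trans ((Finset.sum_le_sum fun i _ => e3 i).trans_eq ?_)
    simp
  have hLC : 3 * L ≤ ENNReal.ofReal (3 * √(A * C) + 1) := by
    rw [hL, show (3 : ℝ≥0∞) = ENNReal.ofReal 3 by simp, ← ENNReal.ofReal_mul (by norm_num)]
    exact ENNReal.ofReal_le_ofReal (by linarith)
  set a := eLpNorm h 2 (phaseMeasure R)
  set b := eLpNorm g₀ 2 (phaseMeasure R)
  set c := eLpNorm g₁ 2 (phaseMeasure R)
  have h13 : (1 : ℝ≥0∞) ≤ 3 := by norm_num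
  calc ‖X‖ₑ ≤ ‖Yh‖ₑ + ‖(2 * Real.pi : ℂ)⁻¹‖ₑ * ‖Y₀ - ∑ i, Y₁ i‖ₑ := by
        rw [hX, ← enorm_mul]; exact enorm_add_le _ _
    _ ≤ a * (L * N) + 1 * (b * (L * N) + 3 * (c * (L * N))) := by
        refine add_le_add e1 (mul_le_mul' hpi1 ?_)
        exact enorm_sub_le.trans (add_le_add e2 e4)
    _ ≤ 3 * (a * (L * N)) + (3 * (b * (L * N)) + 3 * (c * (L * N))) := by
        rw [one_mul]
        exact add_le_add (le_mul_of_one_le_left' h13)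
          (add_le_add (le_mul_of_one_le_left' h13) le_rfl)
    _ = 3 * L * (a + b + c) * N := by ring
    _ ≤ _ := by gcongr

end MomentumAveraging

open MomentumAveraging in
theorem lemma5p1 (R : ℝ) (hR : 0 < R) (ψ : 𝓓(momentumBall R, ℂ)) :
    ∃ C : ℝ, 0 < C ∧
      ∀ (h g₀ : SpaceTime × E3 → ℂ) (g₁ : SpaceTime × E3 → EuclideanSpace ℂ (Fin 3)),
        MemLp h 2 (phaseMeasure R) →
        MemLp g₀ 2 (phaseMeasure R) →
        MemLp g₁ 2 (phaseMeasure R) →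
        IsDistribSolution R h g₀ g₁ →
        (∀ᵐ z : SpaceTime, IntegrableOn (fun p => ψ p * h (z, p)) (Metric.ball 0 R)) ∧
        ∃ hu : MemLp (average R ψ h) 2 (volume : Measure SpaceTime),
          TemperedDistribution.MemSobolev (1 / 4) 2
            ((hu.toLp (average R ψ h) : Lp ℂ 2 (volume : Measure SpaceTime)) :
              𝓢'(SpaceTime, ℂ)) ∧
          sobolevNorm (1 / 4) (hu.toLp (average R ψ h)) ≤
            ENNReal.ofReal C *
              (eLpNorm h 2 (phaseMeasure R) + eLpNorm g₀ 2 (phaseMeasure R) +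
                eLpNorm g₁ 2 (phaseMeasure R)) := by
  obtain ⟨C, hC0, hC⟩ := exists_enorm_integral_average_mul_fourier_le hR ψ
  refine ⟨C, hC0, fun h g₀ g₁ hh hg₀ hg₁ hsol => ?_⟩
  have hψL : MemLp ψ 2 (volume.restrict (Metric.ball (0 : E3) R)) :=
    ψ.continuous.memLp_of_hasCompactSupport ψ.hasCompactSupport
  have hu := memLp_average ψ.continuous hψL hh
  set u : Lp ℂ 2 (volume : Measure SpaceTime) := hu.toLp (average R ψ h) with hud
  have hMtop : ENNReal.ofReal C * (eLpNorm h 2 (phaseMeasure R) + eLpNorm g₀ 2 (phaseMeasure R) +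
      eLpNorm g₁ 2 (phaseMeasure R)) ≠ ∞ :=
    ENNReal.mul_ne_top ENNReal.ofReal_ne_top (ENNReal.add_ne_top.2
      ⟨ENNReal.add_ne_top.2 ⟨hh.eLpNorm_ne_top, hg₀.eLpNorm_ne_top⟩, hg₁.eLpNorm_ne_top⟩)
  have hnorm : sobolevNorm (1 / 4) u ≤ ENNReal.ofReal C * (eLpNorm h 2 (phaseMeasure R) +
      eLpNorm g₀ 2 (phaseMeasure R) + eLpNorm g₁ 2 (phaseMeasure R)) := by
    -- Duality applied to `v = û`; symmetry of the Fourier transform moves it onto `θ`, where the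
    -- tested estimate applies.
    refine eLpNorm_weight_mul_le_of_forall_contDiff (Lp.memLp _) continuous_sobolevWeight
      one_le_sobolevWeight hMtop fun θ hθ hθs => ?_
    rw [integral_fourier_mul_eq u hθ hθs]
    have h1 : ∫ z, u z * 𝓕 θ z = ∫ z, average R ψ h z * 𝓕 θ z := by
      refine integral_congr_ae ?_
      filter_upwards [hu.coeFn_toLp] with z hz
      rw [hz]
    rw [h1]
    exact hC h g₀ g₁ hh hg₀ hg₁ hsol θ hθ hθs
  refine ⟨ae_integrableOn_mul_slice hψL hh, hu, memSobolev_of_memLp _ _ ⟨?_, ?_⟩, hnorm⟩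
  · exact (Complex.continuous_ofReal.comp continuous_sobolevWeight).aestronglyMeasurable.mul
      (Lp.aestronglyMeasurable _)
  · exact hnorm.trans_lt hMtop.lt_top
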